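/- Let $n\ge 0$ and let $W(A_n)$ be the Coxeter group of type $A_n$, with Coxeter generators $\sigma_1,\dots,\sigma_n$ (in the order of the Coxeter graph). For $1\le i\le j\le n$ put $[i,j]=\sigma_i\sigma_{i+1}\cdots\sigma_j$. An element of $W(A_n)$ is fully commutative if any two of its reduced expressions can be transformed into each other by commutation relations only. A non-crossing diagram $D$ on $n+1$ strings consists of a top row of dots $1,\dots,n+1$ and a bottom row of dots $1',\dots,(n+1)'$, numbered from left to right, in which each dot is joined to exactly one other dot, by joins that do not intersect when drawn in the rectangle spanned by the two rows. With the order $1<\dots<n+1<1'<\dots<(n+1)'$, each join is an arrow $(x,y)$ with $x<y$, tail $x$ and head $y$, and $D$ is regarded as a set of arrows. Let $AD$ (resp. $BD$) be the set of arrows of $D$ with both endpoints in the top (resp. bottom) row, and $D^+$ the set of arrows $(x,y)$ of $D$ with $x$ in the top row, $y$ in the bottom row and $x'<y$. Put $$\mathcal I(D)=\{i : i \text{ is the tail of an arrow of } AD\cup D^+\},\qquad \mathcal J(D)=\{j : (j+1)' \text{ is the head of an arrow of } BD\cup D^+\},$$ and call $\sharp(AD\cup D^+)$ the size of $D$. The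 product of two diagrams is $D_1D_2=\delta^{m}\,D_1\ast D_2$, where $D_1\ast D_2$ is obtained by placing $D_2$ below $D_1$ and deleting the $m$ circles so produced. For $1\le k\le n$ let $E_k$ be the diagram with arrows $(k,k+1)$, $(k',(k+1)')$ and $(x,x')$ for $x\ne k,k+1$. For a fully commutative $w$, let $\mathcal D(w)$ be the diagram equal to the product $E_{k_1}\cdots E_{k_\ell}$ for every reduced expression $\sigma_{k_1}\cdots\sigma_{k_\ell}$ of $w$ (no circle occurs in this product, and it does not depend on the reduced expression). Proposition. Let $D$ be a non-crossing diagram on $n+1$ strings, of size $p$. Then $\mathcal I(D)$ and $\mathcal J(D)$ both have $p$ elements; write them in decreasing order as $i_1>\dots>i_p$ and $j_1>\dots>j_p$. Then $1\le i_k\le j_k\le n$ for every $k$, the expression $$w_D=[i_1,j_1][i_2,j_2]\cdots[i_p,j_p]$$ is reduced, the element $w_D$ is fully commutative, $\mathcal D(w_D)=D$, and $w_D$ is the only fully commutative element $w$ of $W(A_n)$ with $\mathcal D(w)=D$; that is, $w_D=\mathcal D^{-1}(D)$. In particular $\mathcal I(D)$ and $\mathcal J(D)$ determine $D$: if $D'$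 is a non-crossing diagram on $n+1$ strings with $\mathcal I(D')=\mathcal I(D)$ and $\mathcal J(D')=\mathcal J(D)$, then $D'=D$. -/

import Mathlib

/-! Dots are numbered `1, …, n + 1` on each line; the dot with number `x + 1` is represented by
`x : Fin (n + 1)`.  The generator `σ_{k + 1}` of `W(A_n)` is represented by `k : Fin n`. -/

namespace FCDiagram

/-- The `2(n+1)` dots, in two rows, with the total order
`1 < 2 < ⋯ < n+1 < 1' < 2' < ⋯ < (n+1)'`. -/
abbrev Dot (n : ℕ) : Type := Fin (n + 1) ⊕ₗ Fin (n + 1)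

/-- A dot of the top line `A`. -/
abbrev top {n : ℕ} (x : Fin (n + 1)) : Dot n := Sum.inlₗ x

/-- A dot `x'` of the bottom line `B`. -/
abbrev bot {n : ℕ} (x : Fin (n + 1)) : Dot n := Sum.inrₗ x

/-- Position of a dot when one walks along the boundary of the rectangle: the top line from left
to right, then the bottom line from right to left. -/
def boundaryPos {n : ℕ} (d : Dot n) : ℕ :=
  Sum.elim (fun x : Fin (n + 1) => (x : ℕ)) (fun x : Fin (n + 1) => 2 * n + 1 - (x : ℕ)) (ofLex d)

/-- `u` and `v` are the two endpoints of an arrow of `D`. -/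
def Joined {n : ℕ} (D : Set (Dot n × Dot n)) (u v : Dot n) : Prop :=
  (u, v) ∈ D ∨ (v, u) ∈ D

/-- A non-crossing diagram on `n + 1` strings, as a set of arrows `(x, y)` with `x < y`.
Two joins can be drawn in the rectangle without intersecting exactly when their endpoints
do not alternate along its boundary. -/
structure IsNonCrossingDiagram {n : ℕ} (D : Set (Dot n × Dot n)) : Prop where
  lt : ∀ a ∈ D, a.1 < a.2
  existsUnique : ∀ d : Dot n, ∃! a : Dot n × Dot n, a ∈ D ∧ (a.1 = d ∨ a.2 = d)
  nonCrossing : ∀ u s v t : Dot n, boundaryPos u < boundaryPos s → boundaryPos s < boundaryPos v →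
    boundaryPos v < boundaryPos t → ¬ (Joined D u v ∧ Joined D s t)

/-- Arrows in the top row. -/
def topArrows {n : ℕ} (D : Set (Dot n × Dot n)) : Set (Dot n × Dot n) :=
  {a ∈ D | ∃ x y : Fin (n + 1), a = (top x, top y)}

/-- Arrows in the bottom row. -/
def botArrows {n : ℕ} (D : Set (Dot n × Dot n)) : Set (Dot n × Dot n) :=
  {a ∈ D | ∃ x y : Fin (n + 1), a = (bot x, bot y)}

/-- Positive arrows from the top row to the bottom row: `(x, y)` with `x' < y`. -/
def posArrows {n : ℕ} (D : Set (Dot n × Dot n)) : Set (Dot n × Dot n) :=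
  {a ∈ D | ∃ x y : Fin (n + 1), a = (top x, bot y) ∧ bot x < (bot y : Dot n)}

/-- `𝓘(D)`, the set of numbers of the tails of the arrows in `AD ∪ D⁺`. -/
def tailSet {n : ℕ} (D : Set (Dot n × Dot n)) : Set ℕ :=
  {i | ∃ (x : Fin (n + 1)) (y : Dot n),
    i = (x : ℕ) + 1 ∧ (top x, y) ∈ topArrows D ∪ posArrows D}

/-- `𝓙(D)`, the set of the `j` in `{1, …, n+1}` such that `(j+1)'` is the head of an arrow in
`BD ∪ D⁺`. -/
def headSet {n : ℕ} (D : Set (Dot n × Dot n)) : Set ℕ :=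
  {j | 1 ≤ j ∧ j ≤ n + 1 ∧ ∃ (x : Dot n) (y : Fin (n + 1)),
    j + 1 = (y : ℕ) + 1 ∧ (x, bot y) ∈ botArrows D ∪ posArrows D}

/-- The size of `D`. -/
noncomputable def size {n : ℕ} (D : Set (Dot n × Dot n)) : ℕ :=
  (topArrows D ∪ posArrows D).ncard

/-! ### Concatenation -/

/-- A row (`0` is the highest) and a place in it, for three rows of `n + 1` dots. -/
abbrev StackDot (n : ℕ) : Type := Fin 3 × Fin (n + 1)

/-- Places the two rows of a diagram on the rows `r` and `r'` of the stack. -/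
def place {n : ℕ} (r r' : Fin 3) (d : Dot n) : StackDot n :=
  Sum.elim (fun x : Fin (n + 1) => (r, x)) (fun x : Fin (n + 1) => (r', x)) (ofLex d)

/-- The graph drawn when `D₂` is placed below `D₁`, the bottom line of `D₁` being glued to the
top line of `D₂`. -/
def stackGraph {n : ℕ} (D₁ D₂ : Set (Dot n × Dot n)) : SimpleGraph (StackDot n) :=
  SimpleGraph.fromRel fun u v =>
    (∃ a ∈ D₁, u = place 0 1 a.1 ∧ v = place 0 1 a.2) ∨
    (∃ a ∈ D₂, u = place 1 2 a.1 ∧ v = place 1 2 a.2)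

/-- The concatenation `D₁ ∗ D₂`, circles being deleted. -/
def concat {n : ℕ} (D₁ D₂ : Set (Dot n × Dot n)) : Set (Dot n × Dot n) :=
  {a | a.1 < a.2 ∧ (stackGraph D₁ D₂).Reachable (place 0 2 a.1) (place 0 2 a.2)}

/-- The number `m(D₁, D₂)` of circles deleted in `D₁ ∗ D₂`: they are the connected components
all of whose dots lie in the middle row. -/
noncomputable def circles {n : ℕ} (D₁ D₂ : Set (Dot n × Dot n)) : ℕ :=
  {c : (stackGraph D₁ D₂).ConnectedComponent | ∀ v ∈ c.supp, v.1 = 1}.ncard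

/-- The diagram with arrows `(x, x')`. -/
def idDiagram (n : ℕ) : Set (Dot n × Dot n) :=
  {a | ∃ x : Fin (n + 1), a = (top x, bot x)}

/-- The diagram `E_{k+1}`. -/
def genDiagram {n : ℕ} (k : Fin n) : Set (Dot n × Dot n) :=
  {(top k.castSucc, top k.succ), (bot k.castSucc, bot k.succ)} ∪
    {a | ∃ x : Fin (n + 1), x ≠ k.castSucc ∧ x ≠ k.succ ∧ a = (top x, bot x)}

/-- The product of the diagrams `E` along a word, in the diagram algebra with multiplication
`D₁ D₂ = δ ^ m(D₁, D₂) • (D₁ ∗ D₂)`; the pair `(m, D)` stands for `δ ^ m • D`. -/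
noncomputable def monomial {n : ℕ} (ω : List (Fin n)) : ℕ × Set (Dot n × Dot n) :=
  ω.foldl (fun P k => (P.1 + circles P.2 (genDiagram k), concat P.2 (genDiagram k)))
    (0, idDiagram n)

/-! ### Fully commutative elements -/

/-- `ω'` is obtained from `ω` by one commutation relation `s t = t s` with `m_{st} = 2`. -/
def CommStep {B : Type*} (M : CoxeterMatrix B) (ω ω' : List B) : Prop :=
  ∃ (l r : List B) (s t : B), M s t = 2 ∧ ω = l ++ [s, t] ++ r ∧ ω' = l ++ [t, s] ++ r

/-- One can pass from any reduced expression of `w` to any other by commutation relations. -/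
def IsFullyCommutative {B W : Type*} [Group W] {M : CoxeterMatrix B} (cs : CoxeterSystem M W)
    (w : W) : Prop :=
  ∀ ω ω' : List B, cs.IsReduced ω → cs.IsReduced ω' → cs.wordProd ω = w → cs.wordProd ω' = w →
    Relation.ReflTransGen (CommStep M) ω ω'

/-- The Coxeter group `W(A_n)` with its generators. -/
abbrev cox (n : ℕ) : CoxeterSystem (CoxeterMatrix.A n) (CoxeterMatrix.A n).Group :=
  (CoxeterMatrix.A n).toCoxeterSystem

/-- The word `σ_i σ_{i+1} ⋯ σ_j`, for `1 ≤ i ≤ j ≤ n`. -/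
def block (n i j : ℕ) : List (Fin n) :=
  (List.finRange n).filter fun k => i ≤ (k : ℕ) + 1 ∧ (k : ℕ) + 1 ≤ j

/-- The word `[i₁, j₁] [i₂, j₂] ⋯ [i_p, j_p]`. -/
def pairsWord (n : ℕ) {p : ℕ} (i j : Fin p → ℕ) : List (Fin n) :=
  (List.ofFn fun k => block n (i k) (j k)).flatten

/-- `D = 𝓓(w)`: the monomial `e_w`, formed along any reduced expression of `w`, is sent to the
basis element `D` of the diagram algebra when each `e_k` is sent to `E_k`. -/
def IsDiagramOf {n : ℕ} (w : (CoxeterMatrix.A n).Group) (D : Set (Dot n × Dot n)) : Prop :=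
  ∀ ω : List (Fin n), (cox n).IsReduced ω → (cox n).wordProd ω = w → monomial ω = (0, D)

end FCDiagram

/-! Give the top dot `x` the coordinate `-x` and the bottom dot `y'` the coordinate `y`. A diagram
becomes an involution of the integers without nonzero fixed points, and "non-crossing" becomes
"joins are nested or disjoint intervals". Right multiplication by `E_k` is the surgery `joinOp k (k
+ 1)`: join `k` with `k + 1` and their former partners with each other. A circle appears exactly
when `k` and `k + 1` were already joined.

Call a word good if no commutations bring it to contain `s s`, or `s t s` with `m_{st} = 3`. In a
simply laced Coxeter group, the exchange property gives Tits' theorem: reduced words of one element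
are linked by commutations and braid moves. Hence good words are exactly the reduced words of fully
commutative elements (`IsGood.isReduced`, `IsGood.isFullyCommutative`, `IsFullyCommutative.isGood`).

In type `A`, a normal word is a product of blocks `[i, j]` whose starts and ends strictly decrease.
Its neighbouring letters alternate, so it is good (`isAlternating_normalWord`,
`IsAlternating.isGood`). Conversely every good word becomes normal by commutations
(`IsGood.exists_isNormal`).

Multiplying by a block `[i, j]` of a normal word adds `i` to the tails and `j + 1` to the heads and
makes no circle (`wordAct_block`). So the starts and ends of a normal word are read off its diagram,
and the diagram determines the word.

For existence, every planar matching is a product of generators (`exists_wordAct_eq`). A shortest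
such word is good, because the Temperley–Lieb relations would shorten any other; so it may be taken
normal. -/

namespace CoxeterSystem

/-! ### The exchange property of Coxeter groups -/

variable {B W : Type*} [Group W] {M : CoxeterMatrix B} (cs : CoxeterSystem M W)

open Classical in
/-- The action of a simple reflection on signed group elements: conjugation, with a change of sign
at the simple reflection itself. -/
noncomputable def signedConj (i : B) : Function.End (W × ZMod 2) := fun p =>
  (cs.simple i * p.1 * cs.simple i, p.2 + if p.1 = cs.simple i then 1 else 0)

-- The sign changes when the conjugated element meets a simple reflection; pulled back to the
-- initial element, these events are indexed by the elements `s_j (s_i s_j) ^ l`, two for each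
-- factor.
open Classical in
theorem signedConj_mul_pow (i j : B) (k : ℕ) (p : W × ZMod 2) :
    ((cs.signedConj i * cs.signedConj j) ^ k) p =
      ((cs.simple i * cs.simple j) ^ k * p.1 * ((cs.simple i * cs.simple j) ^ k)⁻¹,
        p.2 + ∑ l ∈ Finset.range (2 * k),
          if p.1 = cs.simple j * (cs.simple i * cs.simple j) ^ l then 1 else 0) := by
  induction k with
  | zero => simp; rfl
  | succ k ih =>
    have hmul : ∀ (a b : Function.End (W × ZMod 2)) (q : W × ZMod 2), (a * b) q = a (b q) :=
      fun _ _ _ => rfl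
    rw [pow_succ', hmul, ih, hmul]
    set x := cs.simple i * cs.simple j with hx
    -- Conjugation by `s_j` inverts `x = s_i s_j`.
    have hxj : ∀ l : ℕ, (x ^ l)⁻¹ * cs.simple j = cs.simple j * x ^ l := by
      intro l
      induction l with
      | zero => simp
      | succ l ihl =>
        rw [pow_succ x l, mul_inv_rev, mul_assoc, ihl, hx, mul_inv_rev]
        simp only [inv_simple]
        rw [← hx, ← pow_succ, pow_succ' x l, hx]
        simp [mul_assoc]
    have e1 : (x ^ k * p.1 * (x ^ k)⁻¹ = cs.simple j) ↔ (p.1 = cs.simple j * x ^ (2 * k)) := by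
      rw [mul_inv_eq_iff_eq_mul, ← eq_inv_mul_iff_mul_eq, ← mul_assoc, hxj, mul_assoc,
        ← pow_add, two_mul]
    have e2 : (cs.simple j * (x ^ k * p.1 * (x ^ k)⁻¹) * cs.simple j = cs.simple i) ↔
        (p.1 = cs.simple j * x ^ (2 * k + 1)) := by
      have h1 : (cs.simple j * (x ^ k * p.1 * (x ^ k)⁻¹) * cs.simple j = cs.simple i) ↔
          (x ^ k * p.1 * (x ^ k)⁻¹ = cs.simple j * x) := by
        rw [hx]
        generalize (cs.simple i * cs.simple j) ^ k * p.1 * ((cs.simple i * cs.simple j) ^ k)⁻¹ = z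
        constructor
        · intro h
          rw [← h]; simp [mul_assoc]
        · intro h
          rw [h]; simp [mul_assoc]
      rw [h1, mul_inv_eq_iff_eq_mul, ← eq_inv_mul_iff_mul_eq, mul_assoc (cs.simple j),
        ← mul_assoc, hxj, mul_assoc, ← pow_succ', ← pow_add]
      rw [show k + (k + 1) = 2 * k + 1 by ring]
    simp only [signedConj]
    rw [show 2 * (k + 1) = 2 * k + 1 + 1 by ring, Finset.sum_range_succ, Finset.sum_range_succ]
    simp only [e1, e2]
    refine Prod.ext ?_ ?_
    · simp only [pow_succ' x k, mul_inv_rev]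
      simp only [hx, mul_inv_rev, inv_simple, mul_assoc]
    · simp only [add_assoc]

/-- Since `(s_i s_j) ^ m = 1` for `m = m_{ij}`, the `2m` elements at which the sign changes form one
list of length `m` repeated twice, and the changes cancel modulo 2. -/
theorem isLiftable_signedConj : M.IsLiftable cs.signedConj := by
  classical
  intro i j
  funext p
  rw [signedConj_mul_pow, cs.simple_mul_simple_pow, two_mul, Finset.sum_range_add]
  simp only [pow_add, cs.simple_mul_simple_pow, one_mul]
  rw [CharTwo.add_self_eq_zero]
  simp
  rfl

/-- The signed conjugation action of a Coxeter group. -/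
noncomputable def signedConjHom : W →* Function.End (W × ZMod 2) :=
  cs.lift ⟨cs.signedConj, cs.isLiftable_signedConj⟩

-- The left side depends on the group element alone. So the parity of the number of occurrences of
-- an element in the right inversion sequence does not depend on the word.
open Classical in
theorem signedConjHom_wordProd (ω : List B) (p : W × ZMod 2) :
    cs.signedConjHom (cs.wordProd ω) p =
      (cs.wordProd ω * p.1 * (cs.wordProd ω)⁻¹, p.2 + (cs.rightInvSeq ω).count p.1) := by
  induction ω with
  | nil => simp; rfl
  | cons i ω ih =>
    have hmul : ∀ (a b : Function.End (W × ZMod 2)) (q : W × ZMod 2), (a * b) q = a (b q) :=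
      fun _ _ _ => rfl
    rw [wordProd_cons, map_mul, hmul, ih]
    have hs : cs.signedConjHom (cs.simple i) = cs.signedConj i := cs.lift_apply_simple _ _
    rw [hs, rightInvSeq, List.count_cons]
    have e : (cs.wordProd ω * p.1 * (cs.wordProd ω)⁻¹ = cs.simple i) ↔
        ((cs.wordProd ω)⁻¹ * cs.simple i * cs.wordProd ω = p.1) := by
      constructor
      · intro h; rw [← h]; group
      · intro h; rw [← h]; group
    simp only [signedConj, e, beq_iff_eq]
    refine Prod.ext ?_ ?_
    · simp [mul_assoc]
    · push_cast
      simp [add_assoc]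

/-- The exchange property. -/
theorem IsRightDescent.exists_eraseIdx {ω : List B} {i : B}
    (h : cs.IsRightDescent (cs.wordProd ω) i) :
    ∃ k < ω.length, cs.wordProd ω * cs.simple i = cs.wordProd (ω.eraseIdx k) := by
  classical
  have hd := cs.isRightDescent_iff.1 h
  obtain ⟨ω', hω', hp⟩ := cs.exists_isReduced (cs.wordProd ω * cs.simple i)
  have hw : cs.wordProd ω = cs.wordProd (ω'.concat i) := by
    rw [wordProd_concat, ← hp]; simp
  have hred : cs.IsReduced (ω'.concat i) := by
    unfold IsReduced at hω' ⊢
    rw [← hw, ← hd, hp, hω']; simp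
  -- The inversion sequence of a reduced word has no repetition, so the last letter occurs once. By
  -- parity it also occurs in that of `ω`, and its position is the letter to delete.
  have hc : (cs.rightInvSeq (ω'.concat i)).count (cs.simple i) = 1 := by
    apply List.count_eq_one_of_mem (hred.nodup_rightInvSeq)
    rw [rightInvSeq_concat]; simp
  have h1 := congrArg Prod.snd (cs.signedConjHom_wordProd ω (cs.simple i, 0))
  have h2 := congrArg Prod.snd (cs.signedConjHom_wordProd (ω'.concat i) (cs.simple i, 0))
  rw [← hw, h1] at h2
  simp only [hc, zero_add] at h2
  have hmem : cs.simple i ∈ cs.rightInvSeq ω := by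
    by_contra hn
    rw [List.count_eq_zero_of_not_mem hn] at h2
    simp at h2
  obtain ⟨k, hk, he⟩ := List.mem_iff_getElem.1 hmem
  refine ⟨k, by simpa using hk, ?_⟩
  rw [← cs.wordProd_mul_getD_rightInvSeq, List.getD_eq_getElem _ _ hk, he]

end CoxeterSystem

/-! ### Good words and full commutativity in simply laced Coxeter groups -/

namespace FCDiagram

open Relation

variable {B W : Type*} [Group W] {M : CoxeterMatrix B} (cs : CoxeterSystem M W)

/-- `ω'` is obtained from `ω` by one relation `s t s = t s t` with `m_{st} = 3`. -/
def BraidStep (M : CoxeterMatrix B) (ω ω' : List B) : Prop :=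
  ∃ (l r : List B) (s t : B), M s t = 3 ∧ ω = l ++ [s, t, s] ++ r ∧ ω' = l ++ [t, s, t] ++ r

/-- No word of the commutation class of `ω` has a factor `s s`, or a factor `s t s` with
`m_{st} = 3`. -/
def IsGood (M : CoxeterMatrix B) (ω : List B) : Prop :=
  ∀ ω', ReflTransGen (CommStep M) ω ω' → (∀ s, ¬ [s, s] <:+: ω') ∧
    ∀ s t, M s t = 3 → ¬ [s, t, s] <:+: ω'

theorem CommStep.symm {ω ω' : List B} (h : CommStep M ω ω') : CommStep M ω' ω := by
  obtain ⟨l, r, s, t, hst, rfl, rfl⟩ := h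
  exact ⟨l, r, t, s, by rw [M.symmetric]; exact hst, rfl, rfl⟩

theorem reflTransGen_commStep_symm {ω ω' : List B} (h : ReflTransGen (CommStep M) ω ω') :
    ReflTransGen (CommStep M) ω' ω := by
  induction h with
  | refl => exact .refl
  | tail _ h ih => exact .head h.symm ih

theorem CommStep.append_append {ω ω' : List B} (h : CommStep M ω ω') (a b : List B) :
    CommStep M (a ++ ω ++ b) (a ++ ω' ++ b) := by
  obtain ⟨l, r, s, t, hst, rfl, rfl⟩ := h
  exact ⟨a ++ l, r ++ b, s, t, hst, by simp, by simp⟩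

theorem BraidStep.append_append {ω ω' : List B} (h : BraidStep M ω ω') (a b : List B) :
    BraidStep M (a ++ ω ++ b) (a ++ ω' ++ b) := by
  obtain ⟨l, r, s, t, hst, rfl, rfl⟩ := h
  exact ⟨a ++ l, r ++ b, s, t, hst, by simp, by simp⟩

theorem reflTransGen_commStep_append {ω ω' : List B} (h : ReflTransGen (CommStep M) ω ω')
    (a b : List B) : ReflTransGen (CommStep M) (a ++ ω ++ b) (a ++ ω' ++ b) := by
  induction h with
  | refl => exact .refl
  | tail _ h ih => exact .tail ih (h.append_append a b)

theorem CommStep.perm {ω ω' : List B} (h : CommStep M ω ω') : ω.Perm ω' := by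
  obtain ⟨l, r, s, t, -, rfl, rfl⟩ := h
  exact ((List.Perm.swap t s []).append_left l).append_right r

theorem perm_of_reflTransGen_commStep {ω ω' : List B} (h : ReflTransGen (CommStep M) ω ω') :
    ω.Perm ω' := by
  induction h with
  | refl => exact .refl _
  | tail _ h ih => exact ih.trans h.perm

theorem wordProd_comm {s t : B} (h : M s t = 2) :
    cs.simple s * cs.simple t = cs.simple t * cs.simple s := by
  have := cs.wordProd_braidWord_eq s t
  simpa [CoxeterSystem.braidWord, M.symmetric t s, h, CoxeterSystem.alternatingWord,
    CoxeterSystem.wordProd] using this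

theorem wordProd_braid {s t : B} (h : M s t = 3) :
    cs.simple s * cs.simple t * cs.simple s = cs.simple t * cs.simple s * cs.simple t := by
  have := cs.wordProd_braidWord_eq t s
  simpa [CoxeterSystem.braidWord, M.symmetric t s, h, CoxeterSystem.alternatingWord,
    CoxeterSystem.wordProd, mul_assoc] using this

theorem CommStep.wordProd_eq {ω ω' : List B} (h : CommStep M ω ω') :
    cs.wordProd ω = cs.wordProd ω' := by
  obtain ⟨l, r, s, t, hst, rfl, rfl⟩ := h
  have := congrArg (· * cs.wordProd r) (wordProd_comm cs hst)
  simpa [CoxeterSystem.wordProd_append, CoxeterSystem.wordProd_cons, mul_assoc] using this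

theorem BraidStep.wordProd_eq {ω ω' : List B} (h : BraidStep M ω ω') :
    cs.wordProd ω = cs.wordProd ω' := by
  obtain ⟨l, r, s, t, hst, rfl, rfl⟩ := h
  have := congrArg (· * cs.wordProd r) (wordProd_braid cs hst)
  simpa [CoxeterSystem.wordProd_append, CoxeterSystem.wordProd_cons, mul_assoc] using this

theorem wordProd_eq_of_reflTransGen {ω ω' : List B} (h : ReflTransGen (CommStep M) ω ω') :
    cs.wordProd ω = cs.wordProd ω' := by
  induction h with
  | refl => rfl
  | tail _ h ih => exact ih.trans (h.wordProd_eq cs)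

theorem isReduced_of_reflTransGen {ω ω' : List B} (h : ReflTransGen (CommStep M) ω ω')
    (hω : cs.IsReduced ω) : cs.IsReduced ω' := by
  unfold CoxeterSystem.IsReduced at *
  rw [← wordProd_eq_of_reflTransGen cs h, hω, (perm_of_reflTransGen_commStep h).length_eq]

theorem IsGood.of_reflTransGen {ω ω' : List B} (h : ReflTransGen (CommStep M) ω ω')
    (hω : IsGood M ω) : IsGood M ω' :=
  fun ω'' h' => hω ω'' (h.trans h')

theorem IsGood.of_append {ω ω' : List B} (h : IsGood M (ω ++ ω')) : IsGood M ω := by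
  intro η hη
  have hη' := reflTransGen_commStep_append hη [] ω'
  simp only [List.nil_append] at hη'
  obtain ⟨h1, h2⟩ := h _ hη'
  have hin : η <:+: η ++ ω' := (List.prefix_append _ _).isInfix
  exact ⟨fun s hs => h1 s (hs.trans hin), fun s t hst hs => h2 s t hst (hs.trans hin)⟩

theorem isReduced_of_length_le {ω : List B} {w : W} (hw : cs.wordProd ω = w)
    (h : ω.length ≤ cs.length w) : cs.IsReduced ω := by
  subst hw
  exact le_antisymm (cs.length_wordProd_le ω) h

theorem isReduced_of_append {ω ω' : List B} (h : cs.IsReduced (ω ++ ω')) : cs.IsReduced ω := by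
  have := h.take ω.length
  simpa using this

theorem isRightDescent_of_isReduced_concat {ω : List B} {s : B} (h : cs.IsReduced (ω ++ [s])) :
    cs.IsRightDescent (cs.wordProd (ω ++ [s])) s := by
  unfold CoxeterSystem.IsRightDescent
  have h' := h
  unfold CoxeterSystem.IsReduced at h'
  rw [h']
  simp only [CoxeterSystem.wordProd_append, CoxeterSystem.wordProd_singleton,
    CoxeterSystem.simple_mul_simple_cancel_right]
  have := cs.length_wordProd_le ω
  simp; omega

/-- Two reduced words of the same element are related by commutations and braid relations, in a
simply laced Coxeter group. -/
theorem reflTransGen_of_wordProd_eq (hM : ∀ s t, s ≠ t → M s t = 2 ∨ M s t = 3)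
    (hinj : Function.Injective cs.simple) (m : ℕ) :
    ∀ ω ω' : List B, ω.length = m → cs.IsReduced ω → cs.IsReduced ω' →
      cs.wordProd ω = cs.wordProd ω' →
      ReflTransGen (fun a b => CommStep M a b ∨ BraidStep M a b) ω ω' := by
  have happ : ∀ (a b : List B) (s : B),
      ReflTransGen (fun a b => CommStep M a b ∨ BraidStep M a b) a b →
      ReflTransGen (fun a b => CommStep M a b ∨ BraidStep M a b) (a ++ [s]) (b ++ [s]) := by
    intro a b s h
    induction h with
    | refl => exact .refl
    | tail _ h ih =>
      refine .tail ih ?_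
      rcases h with h | h
      · exact Or.inl (by simpa using h.append_append [] [s])
      · exact Or.inr (by simpa using h.append_append [] [s])
  induction m with
  | zero =>
    intro ω ω' hl hω hω' hw
    have : ω'.length = 0 := by
      rw [← hω'.eq, ← hw, hω.eq, hl]
    rw [List.length_eq_zero_iff] at hl this
    subst hl this
    exact .refl
  | succ m ih =>
    intro ω ω' hl hω hω' hw
    have hl' : ω'.length = m + 1 := by
      rw [← hω'.eq, ← hw, hω.eq, hl]
    rcases List.eq_nil_or_concat' ω with rfl | ⟨ω₀, s, rfl⟩
    · simp at hl
    rcases List.eq_nil_or_concat' ω' with rfl | ⟨ω₀', t, rfl⟩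
    · simp at hl'
    have hr := isReduced_of_append cs hω
    have hr' := isReduced_of_append cs hω'
    simp only [List.length_append, List.length_singleton, Nat.add_right_cancel_iff] at hl hl'
    have hlen : cs.length (cs.wordProd (ω₀ ++ [s])) = m + 1 := by rw [hω.eq]; simp [hl]
    have hlen0 : cs.length (cs.wordProd ω₀) = m := by rw [hr.eq]; simp [hl]
    have hlen0' : cs.length (cs.wordProd ω₀') = m := by rw [hr'.eq]; simp [hl']
    have hpw : cs.wordProd (ω₀ ++ [s]) = cs.wordProd ω₀ * cs.simple s := by
      simp [CoxeterSystem.wordProd_append]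
    have hpw' : cs.wordProd (ω₀ ++ [s]) = cs.wordProd ω₀' * cs.simple t := by
      rw [hw]; simp [CoxeterSystem.wordProd_append]
    by_cases hst : s = t
    · subst hst
      apply happ
      apply ih _ _ hl hr hr'
      exact mul_right_cancel (hpw.symm.trans hpw')
    -- Write `w = ω₀ s = ω₀' t` with `s ≠ t`. Exchange deletes a letter of `ω₀ s`; it is not the
    -- final `s`, as otherwise `s = t`. Hence `ω₀' = ω₁ s` and `w = ω₁ s t` in the group.
    have hd := isRightDescent_of_isReduced_concat cs hω'
    rw [← hw] at hd
    obtain ⟨k, hk, he⟩ := hd.exists_eraseIdx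
    rw [hpw', CoxeterSystem.simple_mul_simple_cancel_right] at he
    simp only [List.length_append, List.length_singleton] at hk
    have hkl : k ≠ ω₀.length := by
      rintro rfl
      rw [List.eraseIdx_append_of_length_le le_rfl] at he
      simp only [Nat.sub_self, List.eraseIdx_zero, List.tail_cons, List.append_nil] at he
      rw [← he] at hpw
      exact hst (hinj (mul_left_cancel (hpw.symm.trans hpw')))
    rw [List.eraseIdx_append_of_lt_length (by omega)] at he
    set ω₁ := ω₀.eraseIdx k with hω₁
    have hl1 : ω₁.length + 1 = m := by rw [hω₁, List.length_eraseIdx_add_one (by omega), hl]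
    have hA : ReflTransGen (fun a b => CommStep M a b ∨ BraidStep M a b) (ω₁ ++ [s]) ω₀' :=
      ih _ _ (by simp [hl1]) (isReduced_of_length_le cs he.symm (by simp [hl1, hlen0'])) hr'
        he.symm
    have hw1 : cs.wordProd (ω₀ ++ [s]) = cs.wordProd ω₁ * cs.simple s * cs.simple t := by
      rw [hpw', he]; simp [CoxeterSystem.wordProd_append]
    rcases hM s t hst with h2 | h3
    · have hcm := wordProd_comm cs h2
      have he2 : cs.wordProd ω₀ = cs.wordProd (ω₁ ++ [t]) := by
        have : cs.wordProd ω₀ * cs.simple s = cs.wordProd ω₁ * cs.simple t * cs.simple s := by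
          rw [← hpw, hw1, mul_assoc, hcm, mul_assoc]
        rw [mul_right_cancel this]; simp [CoxeterSystem.wordProd_append]
      have hC := ih ω₀ (ω₁ ++ [t]) hl hr
        (isReduced_of_length_le cs he2.symm (by simp [hl1, hlen0])) he2
      -- The chain is `ω₀ s ~ ω₁ t s ~ ω₁ s t ~ ω₀' t`, by induction at both ends.
      refine ((happ _ _ s hC).tail (Or.inl ?_)).trans (happ _ _ t hA)
      exact ⟨ω₁, [], t, s, by rw [M.symmetric]; exact h2, by simp, by simp⟩
    · have hd' := isRightDescent_of_isReduced_concat cs hω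
      have hw1' : cs.wordProd (ω₀ ++ [s]) = cs.wordProd (ω₁ ++ [s, t]) := by
        rw [hw1]; simp [CoxeterSystem.wordProd_append, CoxeterSystem.wordProd_cons, mul_assoc]
      rw [hw1'] at hd'
      -- A second exchange, on `ω₁ s t` with descent `s`. Deleting `s` would make `s` and `t`
      -- commute, and deleting `t` would contradict the length. So a letter of `ω₁` goes, and `w =
      -- ω₂ s t s` with `ω₀ = ω₂ s t` and `ω₀' = ω₂ t s`.
      obtain ⟨j, hj, hej⟩ := hd'.exists_eraseIdx
      rw [← hw1', hpw, CoxeterSystem.simple_mul_simple_cancel_right] at hej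
      simp only [List.length_append, List.length_cons, List.length_nil] at hj
      have hj1 : j ≠ ω₁.length := by
        rintro rfl
        rw [List.eraseIdx_append_of_length_le le_rfl] at hej
        simp only [Nat.sub_self, List.eraseIdx_zero, List.tail_cons,
          CoxeterSystem.wordProd_append, CoxeterSystem.wordProd_singleton] at hej
        rw [hej, hw1, mul_assoc, mul_assoc] at hpw
        have hcm := mul_left_cancel hpw
        have hb := wordProd_braid cs h3
        rw [hcm, mul_assoc] at hb
        simp only [CoxeterSystem.simple_mul_simple_self, mul_one] at hb
        rw [← hcm, CoxeterSystem.simple_mul_simple_cancel_right] at hb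
        exact hst (hinj hb.symm)
      have hj2 : j ≠ ω₁.length + 1 := by
        rintro rfl
        rw [List.eraseIdx_append_of_length_le (by omega)] at hej
        simp only [Nat.add_sub_cancel_left, List.eraseIdx_cons_succ, List.eraseIdx_zero,
          List.tail_cons, CoxeterSystem.wordProd_append, CoxeterSystem.wordProd_singleton] at hej
        rw [hej, CoxeterSystem.simple_mul_simple_cancel_right] at hpw
        have := cs.length_wordProd_le ω₁
        rw [← hpw] at this
        omega
      rw [List.eraseIdx_append_of_lt_length (by omega)] at hej
      set ω₂ := ω₁.eraseIdx j with hω₂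
      have hl2 : ω₂.length + 2 = m := by
        have := List.length_eraseIdx_add_one (l := ω₁) (i := j) (by omega)
        rw [← hω₂] at this
        omega
      have hb := wordProd_braid cs h3
      have he3 : cs.wordProd (ω₂ ++ [t, s]) = cs.wordProd ω₀' := by
        apply mul_right_cancel (b := cs.simple t)
        rw [← hpw', hpw, hej]
        simp only [CoxeterSystem.wordProd_append, CoxeterSystem.wordProd_cons,
          CoxeterSystem.wordProd_nil, mul_one]
        simp only [mul_assoc] at hb ⊢
        rw [hb]
      have hC := ih ω₀ (ω₂ ++ [s, t]) hl hr
        (isReduced_of_length_le cs hej.symm (by simp [hl2, hlen0])) hej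
      have hE := ih (ω₂ ++ [t, s]) ω₀' (by simp [hl2])
        (isReduced_of_length_le cs he3 (by simp [hl2, hlen0'])) hr' he3
      refine ((happ _ _ s hC).tail (Or.inr ?_)).trans (happ _ _ t hE)
      exact ⟨ω₂, [], s, t, h3, by simp, by simp⟩

/-- No word reached from a good word by commutations admits a braid move, so the chain given by
Tits' theorem consists of commutations only. -/
theorem IsGood.reflTransGen (hM : ∀ s t, s ≠ t → M s t = 2 ∨ M s t = 3)
    (hinj : Function.Injective cs.simple) {ω ω' : List B} (h : IsGood M ω)
    (hω : cs.IsReduced ω) (hω' : cs.IsReduced ω') (hw : cs.wordProd ω = cs.wordProd ω') :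
    ReflTransGen (CommStep M) ω ω' := by
  have := reflTransGen_of_wordProd_eq cs hM hinj _ ω ω' rfl hω hω' hw
  clear hω' hw
  induction this with
  | refl => exact .refl
  | tail _ hs ih =>
    rcases hs with hs | ⟨l, r, s, t, hst, rfl, -⟩
    · exact ih.tail hs
    · exact absurd ⟨l, r, rfl⟩ ((h _ ih).2 s t hst)

/-- If `ω` is reduced but `ω s` is not, then the element of `ω` has a reduced word ending in `s`.
Commutations take the good word `ω` to it, and `ω s` then shows a factor `s s`. -/
theorem IsGood.isReduced (hM : ∀ s t, s ≠ t → M s t = 2 ∨ M s t = 3)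
    (hinj : Function.Injective cs.simple) {ω : List B} (h : IsGood M ω) : cs.IsReduced ω := by
  induction ω using List.reverseRecOn with
  | nil => simp [CoxeterSystem.IsReduced]
  | append_singleton ω s ih =>
    have hr := ih h.of_append
    by_contra hn
    have hd : cs.length (cs.wordProd ω * cs.simple s) + 1 = cs.length (cs.wordProd ω) := by
      rcases cs.length_mul_simple (cs.wordProd ω) s with h1 | h1
      · exfalso
        apply hn
        unfold CoxeterSystem.IsReduced
        rw [CoxeterSystem.wordProd_append, CoxeterSystem.wordProd_singleton, h1, hr.eq]
        simp
      · exact h1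
    obtain ⟨ω₁, h1, h2⟩ := cs.exists_isReduced (cs.wordProd ω * cs.simple s)
    have h3 : cs.wordProd ω = cs.wordProd (ω₁ ++ [s]) := by
      rw [CoxeterSystem.wordProd_append, ← h2]; simp
    have h4 : cs.IsReduced (ω₁ ++ [s]) := by
      apply isReduced_of_length_le cs h3.symm
      rw [← hd, h2, h1.eq]; simp
    have h5 := reflTransGen_commStep_append
      (h.of_append.reflTransGen cs hM hinj hr h4 h3) [] [s]
    exact (h _ h5).1 s ⟨ω₁, [], by simp⟩

theorem IsGood.isFullyCommutative (hM : ∀ s t, s ≠ t → M s t = 2 ∨ M s t = 3)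
    (hinj : Function.Injective cs.simple) {ω : List B} (h : IsGood M ω) :
    IsFullyCommutative cs (cs.wordProd ω) := by
  intro ω₁ ω₂ h1 h2 hw1 hw2
  have hr := h.isReduced cs hM hinj
  exact (reflTransGen_commStep_symm (h.reflTransGen cs hM hinj hr h1 hw1.symm)).trans
    (h.reflTransGen cs hM hinj hr h2 hw2.symm)

/-- Reduced words of fully commutative elements are good. -/
theorem IsFullyCommutative.isGood {ω : List B} (h : IsFullyCommutative cs (cs.wordProd ω))
    (hω : cs.IsReduced ω) : IsGood M ω := by
  classical
  intro ω' hω'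
  have hr := isReduced_of_reflTransGen cs hω' hω
  have hp := wordProd_eq_of_reflTransGen cs hω'
  constructor
  · rintro s ⟨l, r, rfl⟩
    have hle := cs.length_wordProd_le (l ++ r)
    have he : cs.wordProd (l ++ [s, s] ++ r) = cs.wordProd (l ++ r) := by
      simp [CoxeterSystem.wordProd_append, CoxeterSystem.wordProd_cons]
    rw [← he, hr.eq] at hle
    simp at hle
  · rintro s t hst ⟨l, r, rfl⟩
    have hstep : BraidStep M (l ++ [s, t, s] ++ r) (l ++ [t, s, t] ++ r) :=
      ⟨l, r, s, t, hst, rfl, rfl⟩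
    have hpb := hstep.wordProd_eq cs
    have hrb : cs.IsReduced (l ++ [t, s, t] ++ r) := by
      unfold CoxeterSystem.IsReduced at *
      rw [← hpb, hr]; simp
    -- Commutations permute letters, whereas `s t s → t s t` changes the number of letters `s`.
    have hperm := perm_of_reflTransGen_commStep (h _ _ hr hrb hp.symm (hpb.symm.trans hp.symm))
    have hne : s ≠ t := by
      rintro rfl
      rw [M.diagonal] at hst
      omega
    have hc := hperm.count_eq s
    simp [hne.symm] at hc

end FCDiagram

namespace FCDiagram

open Relation

/-! ### Words in type `A` -/

section TypeA

variable {n : ℕ}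

theorem typeA_eq_two_iff (s t : Fin n) : (CoxeterMatrix.A n) s t = 2 ↔
    (s : ℕ) ≠ t ∧ (s : ℕ) + 1 ≠ t ∧ (t : ℕ) + 1 ≠ s := by
  have : (CoxeterMatrix.A n) s t =
    if s = t then 1 else (if (t : ℕ) + 1 = s ∨ (s : ℕ) + 1 = t then 3 else 2) := rfl
  rw [this]
  split_ifs with h1 h2 <;> simp only [Fin.ext_iff] at h1 <;> omega

theorem typeA_eq_three_iff (s t : Fin n) : (CoxeterMatrix.A n) s t = 3 ↔
    (s : ℕ) + 1 = t ∨ (t : ℕ) + 1 = s := by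
  have : (CoxeterMatrix.A n) s t =
    if s = t then 1 else (if (t : ℕ) + 1 = s ∨ (s : ℕ) + 1 = t then 3 else 2) := rfl
  rw [this]
  split_ifs with h1 h2 <;> simp only [Fin.ext_iff] at h1 <;> omega

theorem typeA_eq_two_or_three (s t : Fin n) (h : s ≠ t) :
    (CoxeterMatrix.A n) s t = 2 ∨ (CoxeterMatrix.A n) s t = 3 := by
  rw [typeA_eq_two_iff, typeA_eq_three_iff]
  rw [Ne, Fin.ext_iff] at h
  omega

/-- The representation by adjacent transpositions of `ℕ` serves only to show that distinct
generators are distinct group elements. -/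
theorem isLiftable_swap : (CoxeterMatrix.A n).IsLiftable
    (fun i : Fin n => Equiv.swap (i : ℕ) ((i : ℕ) + 1)) := by
  have key : ∀ a : ℕ, (Equiv.swap a (a + 1) * Equiv.swap (a + 1) (a + 2)) ^ 3 = 1 := by
    intro a
    have h1 := Equiv.swap_mul_swap_mul_swap (x := a + 2) (y := a + 1) (z := a) (by simp) (by simp)
    have h2 := Equiv.swap_mul_swap_mul_swap (x := a) (y := a + 1) (z := a + 2) (by simp) (by simp)
    rw [Equiv.swap_comm (a + 1) a, Equiv.swap_comm (a + 2) (a + 1)] at h1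
    rw [Equiv.swap_comm (a + 2) a] at h2
    calc _ = (Equiv.swap a (a + 1) * Equiv.swap (a + 1) (a + 2) * Equiv.swap a (a + 1)) *
          (Equiv.swap (a + 1) (a + 2) * Equiv.swap a (a + 1) * Equiv.swap (a + 1) (a + 2)) := by
          simp only [pow_succ, pow_zero, one_mul, mul_assoc]
      _ = 1 := by rw [h1, h2, Equiv.swap_mul_self]
  intro i j
  by_cases hij : i = j
  · subst hij
    rw [CoxeterMatrix.diagonal]; simp
  rcases typeA_eq_two_or_three i j hij with h | h
  · rw [h]
    rw [typeA_eq_two_iff] at h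
    have hd : (Equiv.swap (i : ℕ) (i + 1)).Disjoint (Equiv.swap (j : ℕ) (j + 1)) := by
      intro x
      by_cases hx : x = i ∨ x = i + 1
      · right
        apply Equiv.swap_apply_of_ne_of_ne <;> omega
      · left
        apply Equiv.swap_apply_of_ne_of_ne <;> omega
    rw [hd.commute.mul_pow, pow_two, pow_two]
    simp
  · rw [h]
    rw [typeA_eq_three_iff] at h
    rcases h with h | h
    · simp only [← h]; exact key _
    · simp only [← h]
      rw [← inv_inj, ← inv_pow, mul_inv_rev, Equiv.swap_inv, Equiv.swap_inv, inv_one]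
      exact key _

theorem cox_simple_injective : Function.Injective (cox n).simple := by
  intro i j hij
  have h := congrArg ((cox n).lift ⟨_, isLiftable_swap⟩) hij
  rw [CoxeterSystem.lift_apply_simple, CoxeterSystem.lift_apply_simple] at h
  have h1 := congrArg (fun e : Equiv.Perm ℕ => e i) h
  simp only [Equiv.swap_apply_left] at h1
  rw [Equiv.swap_apply_def] at h1
  apply Fin.ext
  split_ifs at h1 <;> omega

/-- The letters `σ_k` and `σ_{k+1}` alternate in `ω`, for every `k`. -/
def IsAlternating (ω : List (Fin n)) : Prop :=
  ∀ k : ℕ, (ω.filter fun s : Fin n => (s : ℕ) + 1 = k ∨ (s : ℕ) = k).IsChain (· ≠ ·)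

/-- Two commuting letters are neither equal nor neighbours, so at most one of them survives each
filter and their exchange is invisible there. -/
theorem IsAlternating.of_reflTransGen {ω ω' : List (Fin n)} (h : IsAlternating ω)
    (hc : ReflTransGen (CommStep (CoxeterMatrix.A n)) ω ω') : IsAlternating ω' := by
  induction hc with
  | refl => exact h
  | tail _ hs ih =>
    obtain ⟨l, r, s, t, hst, rfl, rfl⟩ := hs
    rw [typeA_eq_two_iff] at hst
    intro k
    have := ih k
    convert this using 1
    simp only [List.filter_append, List.filter_cons, List.filter_nil, decide_eq_true_eq]
    split_ifs <;> first | rfl | omega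

theorem IsAlternating.isGood {ω : List (Fin n)} (h : IsAlternating ω) :
    IsGood (CoxeterMatrix.A n) ω := by
  intro ω' hc
  have h' := h.of_reflTransGen hc
  have key : ∀ (k : ℕ) (s : Fin n) (η : List (Fin n)), η <:+: ω' →
      η.filter (fun s : Fin n => (s : ℕ) + 1 = k ∨ (s : ℕ) = k) ≠ [s, s] := by
    intro k s η hη he
    have := (h' k).infix (hη.filter _)
    rw [he] at this
    simp at this
  constructor
  · intro s hs
    exact key s s _ hs (by simp)
  · intro s t hst hs
    rw [typeA_eq_three_iff] at hst
    rcases hst with hst | hst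
    -- The pair of neighbouring letters is chosen to contain `s` but not `t`, so that `s t s` is
    -- filtered to `s s`: the pair `s - 1, s` when `t = s + 1`, the pair `s, s + 1` when `t = s -
    -- 1`.
    · refine key s s _ hs ?_
      have : ¬ (((t : ℕ) + 1 = s) ∨ (t : ℕ) = s) := by omega
      simp [this]
    · refine key (s + 1) s _ hs ?_
      have : ¬ (((t : ℕ) + 1 = s + 1) ∨ (t : ℕ) = s + 1) := by omega
      have h1 : ¬ (t : ℕ) = s + 1 := by omega
      have h2 : ¬ (t : ℕ) = s := by omega
      simp only [List.filter_cons, List.filter_nil, decide_eq_true_eq, add_left_inj, h1, h2]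
      simp

theorem reflTransGen_append_singleton {ω : List (Fin n)} {s : Fin n}
    (h : ∀ t ∈ ω, (CoxeterMatrix.A n) s t = 2) :
    ReflTransGen (CommStep (CoxeterMatrix.A n)) (ω ++ [s]) ([s] ++ ω) := by
  induction ω with
  | nil => exact .refl
  | cons t ω ih =>
    have h1 := reflTransGen_commStep_append (ih fun u hu => h u (by simp [hu])) [t] []
    simp only [List.append_nil] at h1
    refine ReflTransGen.tail h1 ⟨[], ω, t, s, ?_, by simp, by simp⟩
    rw [CoxeterMatrix.symmetric]
    exact h t (by simp)

end TypeA

/-! ### Blocks -/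

section Blocks

variable {n : ℕ}

theorem mem_block {i j : ℕ} {s : Fin n} : s ∈ block n i j ↔ i ≤ (s : ℕ) + 1 ∧ (s : ℕ) + 1 ≤ j := by
  simp [block]

theorem pairwise_block (i j : ℕ) : (block n i j).Pairwise (· < ·) :=
  (List.pairwise_lt_finRange n).filter _

theorem eq_of_pairwise_lt {l l' : List (Fin n)} (h : l.Pairwise (· < ·)) (h' : l'.Pairwise (· < ·))
    (hm : ∀ a, a ∈ l ↔ a ∈ l') : l = l' := by
  refine List.Perm.eq_of_pairwise (fun a b _ _ hab hba => absurd hab hba.not_gt) h h' ?_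
  rw [List.perm_ext_iff_of_nodup (h.imp fun h => h.ne) (h'.imp fun h => h.ne)]
  exact hm

theorem block_append {i k j : ℕ} (hik : i ≤ k + 1) (hkj : k ≤ j) :
    block n i j = block n i k ++ block n (k + 1) j := by
  apply eq_of_pairwise_lt (pairwise_block i j)
  · rw [List.pairwise_append]
    refine ⟨pairwise_block _ _, pairwise_block _ _, ?_⟩
    intro a ha b hb
    rw [mem_block] at ha hb
    rw [Fin.lt_def]; omega
  · intro a
    simp only [List.mem_append, mem_block]
    omega

theorem block_self (s : Fin n) : block n (s + 1) (s + 1) = [s] := by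
  apply eq_of_pairwise_lt (pairwise_block _ _) (by simp)
  intro a
  rw [mem_block, List.mem_singleton, Fin.ext_iff]
  omega

theorem block_eq_nil {i j : ℕ} (h : j < i) : block n i j = [] := by
  rw [List.eq_nil_iff_forall_not_mem]
  intro a ha
  rw [mem_block] at ha
  omega

/-- Splits a block at one of its letters. -/
theorem block_split {i j : ℕ} (s : Fin n) (hi : i ≤ s + 1) (hj : (s : ℕ) + 1 ≤ j) :
    block n i j = block n i s ++ [s] ++ block n (s + 2) j := by
  rw [block_append (k := s) hi (by omega), block_append (i := s + 1) (k := s + 1) (by omega) hj,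
    block_self, List.append_assoc]

/-- Lists of pairs `(i, j)` with `1 ≤ i ≤ j ≤ n`, strictly decreasing in both components. -/
def IsNormal (n : ℕ) (L : List (ℕ × ℕ)) : Prop :=
  L.Pairwise (fun a b => b.1 < a.1 ∧ b.2 < a.2) ∧ ∀ q ∈ L, 1 ≤ q.1 ∧ q.1 ≤ q.2 ∧ q.2 ≤ n

/-- The product of the blocks of a list of pairs. -/
def normalWord (n : ℕ) (L : List (ℕ × ℕ)) : List (Fin n) :=
  L.flatMap fun q => block n q.1 q.2

theorem normalWord_append (L L' : List (ℕ × ℕ)) :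
    normalWord n (L ++ L') = normalWord n L ++ normalWord n L' := by
  simp [normalWord]

theorem normalWord_singleton (q : ℕ × ℕ) : normalWord n [q] = block n q.1 q.2 := by
  simp [normalWord]

theorem isNormal_append_singleton {L : List (ℕ × ℕ)} {q : ℕ × ℕ} :
    IsNormal n (L ++ [q]) ↔ IsNormal n L ∧ (∀ r ∈ L, q.1 < r.1 ∧ q.2 < r.2) ∧
      1 ≤ q.1 ∧ q.1 ≤ q.2 ∧ q.2 ≤ n := by
  unfold IsNormal
  simp only [List.pairwise_append, List.mem_append, List.mem_singleton, forall_eq,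
    List.pairwise_singleton, true_and]
  constructor
  · rintro ⟨⟨h1, h2⟩, h3⟩
    exact ⟨⟨h1, fun r hr => h3 r (Or.inl hr)⟩, h2, h3 q (Or.inr rfl)⟩
  · rintro ⟨⟨h1, h2⟩, h3, h4⟩
    refine ⟨⟨h1, h3⟩, ?_⟩
    rintro r (hr | rfl)
    · exact h2 r hr
    · exact h4

/-- Letters are numbered from 0, so the block contains the letter `k` as soon as it contains any
letter of the pair `k - 1, k`; being increasing, it has `k` as the last of them. -/
theorem getLast?_filter_block {i j k : ℕ} (hkj : k + 1 ≤ j) (hj : j ≤ n) {s : Fin n}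
    (hs : s ∈ ((block n i j).filter fun s : Fin n => (s : ℕ) + 1 = k ∨ (s : ℕ) = k).getLast?) :
    (s : ℕ) = k := by
  have hm := List.mem_of_getLast? hs
  rw [List.mem_filter, mem_block] at hm
  simp only [decide_eq_true_eq] at hm
  have hnil : (block n (k + 2) j).filter (fun s : Fin n => (s : ℕ) + 1 = k ∨ (s : ℕ) = k) = [] := by
    rw [List.filter_eq_nil_iff]
    intro a ha
    rw [mem_block] at ha
    simp only [decide_eq_true_eq]; omega
  rw [block_split ⟨k, by omega⟩ (by simp only; omega) (by simpa using hkj)] at hs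
  simp only [List.filter_append, hnil, List.append_nil] at hs
  rw [List.getLast?_append] at hs
  simp at hs
  rw [← hs]

theorem head?_filter_block {i j k : ℕ} (hik : i ≤ k) (hkj : k ≤ j) (hk : 1 ≤ k) (hj : j ≤ n)
    {s : Fin n}
    (hs : s ∈ ((block n i j).filter fun s : Fin n => (s : ℕ) + 1 = k ∨ (s : ℕ) = k).head?) :
    (s : ℕ) + 1 = k := by
  have hnil : (block n i (k - 1)).filter (fun s : Fin n => (s : ℕ) + 1 = k ∨ (s : ℕ) = k) = [] := by
    rw [List.filter_eq_nil_iff]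
    intro a ha
    rw [mem_block] at ha
    simp only [decide_eq_true_eq]; omega
  rw [block_split ⟨k - 1, by omega⟩ (by simp only; omega) (by simp only; omega)] at hs
  simp only [List.filter_append, hnil, List.nil_append, List.append_assoc] at hs
  rw [List.head?_append] at hs
  have : k - 1 + 1 = k := by omega
  simp [this] at hs
  rw [← hs]
  exact this

theorem getLast?_filter_normalWord {L : List (ℕ × ℕ)} {k : ℕ} (hL : ∀ q ∈ L, k + 1 ≤ q.2 ∧ q.2 ≤ n)
    {s : Fin n}
    (hs : s ∈ ((normalWord n L).filter fun s : Fin n => (s : ℕ) + 1 = k ∨ (s : ℕ) = k).getLast?) :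
    (s : ℕ) = k := by
  induction L using List.reverseRecOn with
  | nil => simp [normalWord] at hs
  | append_singleton L q ih =>
    rw [normalWord_append, normalWord_singleton, List.filter_append, List.getLast?_append] at hs
    rw [Option.mem_def, Option.or_eq_some_iff] at hs
    rcases hs with hs | ⟨-, hs⟩
    · exact getLast?_filter_block (hL q (by simp)).1 (hL q (by simp)).2 hs
    · exact ih (fun q hq => hL q (by simp [hq])) hs

/-- Only the junction with the last block matters. If that block meets `k - 1`, its trace on the
pair starts with `k - 1`, while the earlier blocks end further right and leave a trace ending in
`k`. If it meets only `k`, it starts there, and the earlier blocks start too far right to contain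
`k`. -/
theorem isAlternating_normalWord {L : List (ℕ × ℕ)} (hL : IsNormal n L) :
    IsAlternating (normalWord n L) := by
  intro k
  induction L using List.reverseRecOn with
  | nil => simp [normalWord]
  | append_singleton L q ih =>
    rw [isNormal_append_singleton] at hL
    obtain ⟨hL, hq, h1, h2, h3⟩ := hL
    rw [normalWord_append, normalWord_singleton, List.filter_append, List.isChain_append]
    refine ⟨ih hL, (((pairwise_block _ _).filter _).imp fun h => h.ne).isChain, ?_⟩
    intro x hx y hy hxy
    subst hxy
    have hmy := List.mem_of_head? hy
    have hmx := List.mem_of_getLast? hx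
    simp only [List.mem_filter, mem_block, decide_eq_true_eq] at hmx hmy
    by_cases hik : q.1 ≤ k
    · have hkj : k ≤ q.2 := by
        by_contra hc
        omega
      have e1 := head?_filter_block hik hkj (by omega) h3 hy
      have e2 := getLast?_filter_normalWord (fun r hr => ⟨by have := hq r hr; omega,
        (hL.2 r hr).2.2⟩) hx
      omega
    · obtain ⟨hmx, -⟩ := hmx
      rw [normalWord, List.mem_flatMap] at hmx
      obtain ⟨r, hr, hxr⟩ := hmx
      rw [mem_block] at hxr
      have := hq r hr
      omega

/-- Multiplication of a normal word by a generator, inside good words. -/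
theorem exists_isNormal_append_singleton {L : List (ℕ × ℕ)} (hL : IsNormal n L) (s : Fin n)
    (hg : IsGood (CoxeterMatrix.A n) (normalWord n L ++ [s])) :
    ∃ L', IsNormal n L' ∧
      ReflTransGen (CommStep (CoxeterMatrix.A n)) (normalWord n L ++ [s]) (normalWord n L') ∧
      ∀ q ∈ L', (q.1 = s + 1 ∨ ∃ r ∈ L, r.1 = q.1) ∧ (q.2 = s + 1 ∨ ∃ r ∈ L, r.2 = q.2) := by
  have hsn := s.isLt
  induction L using List.reverseRecOn with
  | nil =>
    refine ⟨[((s : ℕ) + 1, (s : ℕ) + 1)], ?_, ?_, ?_⟩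
    · refine ⟨by simp, ?_⟩
      simp
    · rw [normalWord_singleton, block_self]; exact .refl
    · simp
  | append_singleton L p ih =>
    obtain ⟨i, j⟩ := p
    have hL0 := hL
    rw [isNormal_append_singleton] at hL
    obtain ⟨hL, hq, h1, h2, h3⟩ := hL
    simp only at hq h1 h2 h3
    rw [normalWord_append, normalWord_singleton] at hg ⊢
    simp only at hg ⊢
    -- With `[i, j]` the last block and `σ_{s+1}` the new letter: below `i` it starts a new block;
    -- inside `[i, j]` it contradicts goodness; above `j + 1` it commutes past the block; at `j + 1`
    -- it extends the block.
    rcases lt_or_ge ((s : ℕ) + 1) i with hi | hi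
    · refine ⟨L ++ [(i, j)] ++ [((s : ℕ) + 1, (s : ℕ) + 1)], ?_, ?_, ?_⟩
      · rw [isNormal_append_singleton]
        refine ⟨hL0, ?_, by simp, by simp, hsn⟩
        intro r hr
        simp only [List.mem_append, List.mem_singleton] at hr
        rcases hr with hr | rfl
        · have := hq r hr
          omega
        · omega
      · rw [normalWord_append, normalWord_append, normalWord_singleton, normalWord_singleton,
          block_self]
      · intro q hq
        rw [List.mem_append, List.mem_singleton] at hq
        rcases hq with hq | rfl
        · exact ⟨Or.inr ⟨q, hq, rfl⟩, Or.inr ⟨q, hq, rfl⟩⟩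
        · simp
    rcases lt_or_ge ((s : ℕ) + 1) j with hj | hj
    · exfalso
      rw [block_split s hi (by omega), block_split (i := s + 2) (j := j) ⟨s + 1, by omega⟩ le_rfl
        (by simp only; omega), block_eq_nil (i := s + 2) (by simp only; omega)] at hg
      -- The new `s` moves left past the end of the block until it meets `s, s + 1`, giving a factor
      -- `s, s + 1, s`.
      have hc : ReflTransGen (CommStep (CoxeterMatrix.A n))
          (block n (s + 1 + 2) j ++ [s]) ([s] ++ block n (s + 1 + 2) j) := by
        apply reflTransGen_append_singleton
        intro t ht
        rw [mem_block] at ht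
        rw [typeA_eq_two_iff]; omega
      have hc' := reflTransGen_commStep_append hc
        (normalWord n L ++ block n i s ++ [s, ⟨s + 1, by omega⟩]) []
      simp only [List.append_assoc, List.cons_append, List.nil_append, List.append_nil] at hg hc'
      refine (hg _ hc').2 s ⟨s + 1, by omega⟩ (by rw [typeA_eq_three_iff]; simp)
        ⟨normalWord n L ++ block n i s, block n (s + 1 + 2) j, by simp⟩
    rcases hj.eq_or_lt with hj | hj
    · exfalso
      subst hj
      rw [block_split s hi le_rfl, block_eq_nil (i := s + 2) (by omega)] at hg
      exact (hg _ .refl).1 s ⟨normalWord n L ++ block n i s, [], by simp⟩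
    rcases Nat.lt_or_ge (j + 1) ((s : ℕ) + 1) with hj' | hj'
    · have hc : ReflTransGen (CommStep (CoxeterMatrix.A n))
          (block n i j ++ [s]) ([s] ++ block n i j) := by
        apply reflTransGen_append_singleton
        intro t ht
        rw [mem_block] at ht
        rw [typeA_eq_two_iff]; omega
      have hc' := reflTransGen_commStep_append hc (normalWord n L) []
      simp only [List.append_nil, ← List.append_assoc] at hc'
      obtain ⟨L', hn, hr, hm⟩ := ih hL (hg.of_reflTransGen hc').of_append
      refine ⟨L' ++ [(i, j)], ?_, ?_, ?_⟩
      · rw [isNormal_append_singleton]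
        refine ⟨hn, ?_, h1, h2, h3⟩
        intro q hqL
        -- Every new start or end either comes from `L` or equals `s + 1 > j + 1`, so `(i, j)` can
        -- be put back last.
        obtain ⟨ha, hb⟩ := hm q hqL
        simp only
        constructor
        · rcases ha with ha | ⟨r, hr, ha⟩
          · omega
          · rw [← ha]; exact (hq r hr).1
        · rcases hb with hb | ⟨r, hr, hb⟩
          · omega
          · rw [← hb]; exact (hq r hr).2
      · rw [normalWord_append, normalWord_singleton]
        refine hc'.trans ?_
        have := reflTransGen_commStep_append hr [] (block n i j)
        simpa using this
      · intro q hqL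
        rw [List.mem_append, List.mem_singleton] at hqL
        rcases hqL with hqL | rfl
        · obtain ⟨ha, hb⟩ := hm q hqL
          refine ⟨ha.imp_right ?_, hb.imp_right ?_⟩
          · rintro ⟨r, hr, h⟩; exact ⟨r, by simp [hr], h⟩
          · rintro ⟨r, hr, h⟩; exact ⟨r, by simp [hr], h⟩
        · exact ⟨Or.inr ⟨(i, j), by simp, rfl⟩, Or.inr ⟨(i, j), by simp, rfl⟩⟩
    have hjs : j = s := by omega
    subst hjs
    by_cases hlast : ∀ r ∈ L, (s : ℕ) + 1 < r.2
    · refine ⟨L ++ [(i, (s : ℕ) + 1)], ?_, ?_, ?_⟩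
      · rw [isNormal_append_singleton]
        refine ⟨hL, fun r hr => ⟨(hq r hr).1, hlast r hr⟩, h1, hi, hsn⟩
      · rw [normalWord_append, normalWord_singleton]
        simp only
        rw [block_split s hi le_rfl, block_eq_nil (i := s + 2) (by omega)]
        simp only [List.append_assoc, List.append_nil]
        exact .refl
      · intro q hqL
        rw [List.mem_append, List.mem_singleton] at hqL
        rcases hqL with hqL | rfl
        · exact ⟨Or.inr ⟨q, by simp [hqL], rfl⟩, Or.inr ⟨q, by simp [hqL], rfl⟩⟩
        · exact ⟨Or.inr ⟨(i, s), by simp, rfl⟩, Or.inl rfl⟩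
    · exfalso
      push Not at hlast
      obtain ⟨r, hr, hrs⟩ := hlast
      rcases List.eq_nil_or_concat' L with rfl | ⟨L₁, q, rfl⟩
      · simp at hr
      rw [isNormal_append_singleton] at hL
      obtain ⟨hL1, hq1, h1', h2', h3'⟩ := hL
      have hqq := hq q (by simp)
      -- The preceding block already ends in the letter `s`. That letter commutes with all of `[i,
      -- j]` except its last letter `s - 1`, so a factor `s, s - 1, s` appears.
      have hqs : q.2 = s + 1 := by
        rw [List.mem_append, List.mem_singleton] at hr
        rcases hr with hr | rfl
        · have := hq1 r hr
          omega
        · omega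
      have hs1 : 1 ≤ (s : ℕ) := by omega
      rw [normalWord_append, normalWord_singleton, hqs, block_split s (by omega) le_rfl,
        block_eq_nil (i := s + 2) (by omega),
        block_split (i := i) (j := s) ⟨s - 1, by omega⟩ (by simp only; omega) (by simp only; omega),
        block_eq_nil (i := (⟨s - 1, by omega⟩ : Fin n) + 2) (by simp only; omega)] at hg
      have hc : ReflTransGen (CommStep (CoxeterMatrix.A n))
          ([s] ++ block n i (s - 1)) (block n i (s - 1) ++ [s]) := by
        apply reflTransGen_commStep_symm
        apply reflTransGen_append_singleton
        intro t ht
        rw [mem_block] at ht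
        rw [typeA_eq_two_iff]; omega
      have hc' := reflTransGen_commStep_append hc
        (normalWord n L₁ ++ block n q.1 s) [⟨s - 1, by omega⟩, s]
      simp only [List.append_assoc, List.cons_append, List.nil_append, List.append_nil] at hg hc'
      refine (hg _ hc').2 s ⟨s - 1, by omega⟩ (by rw [typeA_eq_three_iff]; simp only; omega)
        ⟨normalWord n L₁ ++ block n q.1 s ++ block n i (s - 1), [], by simp⟩

/-- Every good word is a normal word up to commutations. -/
theorem IsGood.exists_isNormal {ω : List (Fin n)} (h : IsGood (CoxeterMatrix.A n) ω) :
    ∃ L, IsNormal n L ∧ ReflTransGen (CommStep (CoxeterMatrix.A n)) ω (normalWord n L) := by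
  induction ω using List.reverseRecOn with
  | nil => exact ⟨[], ⟨by simp, by simp⟩, .refl⟩
  | append_singleton ω s ih =>
    obtain ⟨L, hL, hr⟩ := ih h.of_append
    have hr' := reflTransGen_commStep_append hr [] [s]
    simp only [List.nil_append] at hr'
    obtain ⟨L', hL', hr'', -⟩ := exists_isNormal_append_singleton hL s (h.of_reflTransGen hr')
    exact ⟨L', hL', hr'.trans hr''⟩

end Blocks

end FCDiagram

namespace FCDiagram

open Relation

/-! ### Diagrams as involutions of the integers

The dot `x` of the top line has the coordinate `-x`, the dot `y'` of the bottom line has the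
coordinate `y`. -/

/-- A perfect matching of the integers `z` with `1 ≤ |z| ≤ N`, extended by `z ↦ -z`. -/
structure IsMatching (N : ℤ) (f : ℤ → ℤ) : Prop where
  invol : ∀ z, f (f z) = z
  zero : f 0 = 0
  ne : ∀ z, z ≠ 0 → f z ≠ z
  out : ∀ z, N < |z| → f z = -z

/-- No two joins cross. -/
def IsPlanar (f : ℤ → ℤ) : Prop :=
  ∀ a b, a < b → b < f a → a < f b ∧ f b < f a

/-- Joins `a` with `b`, and the partner of `a` with the partner of `b`. -/
def joinOp (a b : ℤ) (f : ℤ → ℤ) (z : ℤ) : ℤ :=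
  if z = a then b else if z = b then a else
    if z = f a then f b else if z = f b then f a else f z

/-- The number of circles that arise in the product of a diagram with the generator `k`. -/
def circleCount (f : ℤ → ℤ) (k : ℤ) : ℕ := if f k = k + 1 then 1 else 0

theorem isMatching_neg (N : ℤ) : IsMatching N fun z => -z :=
  ⟨by simp, by simp, by intro z hz; omega, by simp⟩

namespace IsMatching

variable {N : ℤ} {f : ℤ → ℤ}

theorem inj (hf : IsMatching N f) {a b : ℤ} (h : f a = f b) : a = b := by
  rw [← hf.invol a, h, hf.invol]

theorem eq_iff (hf : IsMatching N f) {a b : ℤ} : f a = b ↔ a = f b :=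
  ⟨fun h => by rw [← h, hf.invol], fun h => by rw [h, hf.invol]⟩

theorem apply_ne_zero (hf : IsMatching N f) {z : ℤ} (hz : z ≠ 0) : f z ≠ 0 := by
  intro h
  rw [hf.eq_iff, hf.zero] at h
  exact hz h

theorem abs_apply_le (hf : IsMatching N f) {z : ℤ} (hz : |z| ≤ N) : |f z| ≤ N := by
  by_contra h
  push Not at h
  have := hf.out _ h
  rw [hf.invol] at this
  rw [show f z = -z by omega, abs_neg] at h
  omega

theorem joinOp (hf : IsMatching N f) {a b : ℤ} (hab : a ≠ b) (ha : a ≠ 0) (hb : b ≠ 0)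
    (haN : |a| ≤ N) (hbN : |b| ≤ N) : IsMatching N (joinOp a b f) := by
  have hi := hf.invol
  have h0 := hf.zero
  have hne := hf.ne
  have hinj : ∀ x y, f x = f y → x = y := fun x y => hf.inj
  constructor
  · intro z
    unfold FCDiagram.joinOp
    grind
  · unfold FCDiagram.joinOp
    grind
  · intro z hz
    unfold FCDiagram.joinOp
    grind
  · intro z hz
    have h1 := hf.out z hz
    have h2 := hf.abs_apply_le haN
    have h3 := hf.abs_apply_le hbN
    unfold FCDiagram.joinOp
    grind

end IsMatching

/-- Planarity for all choices of the first endpoint of the two joins, in a form fit for linear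
arithmetic. -/
theorem IsPlanar.chords {f : ℤ → ℤ} (hp : IsPlanar f) (hi : ∀ z, f (f z) = z) (x y : ℤ) :
    ((x < y → y < f x → x < f y ∧ f y < f x) ∧ (x < f y → f y < f x → x < y ∧ y < f x)) ∧
    ((f x < y → y < x → f x < f y ∧ f y < x) ∧ (f x < f y → f y < x → f x < y ∧ y < x)) ∧
    ((y < x → x < f y → y < f x ∧ f x < f y) ∧ (y < f x → f x < f y → y < x ∧ x < f y)) ∧
    ((f y < x → x < y → f y < f x ∧ f x < y) ∧ (f y < f x → f x < y → f y < x ∧ x < y)) := by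
  have h1 := hp x y
  have h2 := hp x (f y)
  have h3 := hp (f x) y
  have h4 := hp (f x) (f y)
  have h5 := hp y x
  have h6 := hp y (f x)
  have h7 := hp (f y) x
  have h8 := hp (f y) (f x)
  simp only [hi] at h1 h2 h3 h4 h5 h6 h7 h8
  exact ⟨⟨h1, h2⟩, ⟨h3, h4⟩, ⟨h5, h6⟩, ⟨h7, h8⟩⟩

/-- By `hbet` the points strictly between `a` and `b` are joined among themselves, so the new join
`a, b` crosses nothing, and the other new join can be drawn along the old ones and beside it. -/
theorem IsPlanar.joinOp {N : ℤ} {f : ℤ → ℤ} (hf : IsMatching N f) (hp : IsPlanar f) {a b : ℤ}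
    (hab : a < b) (ha : a ≠ 0) (hb : b ≠ 0) (hbet : ∀ c, a < c → c < b → a < f c ∧ f c < b) :
    IsPlanar (joinOp a b f) := by
  have hi := hf.invol
  have na := hf.ne a ha
  have nb := hf.ne b hb
  have bet : ∀ c, (a < c → c < b → a < f c ∧ f c < b) ∧ (a < f c → f c < b → a < c ∧ c < b) := by
    intro c
    refine ⟨hbet c, fun h1 h2 => ?_⟩
    have := hbet (f c) h1 h2
    rwa [hi] at this
  have kab := hp.chords hi a b
  have ba := bet a
  have bb := bet b
  intro x y hxy hyx
  by_cases hxa : x = a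
  · subst hxa
    have h1 : FCDiagram.joinOp x b f x = b := by simp [FCDiagram.joinOp]
    rw [h1] at hyx ⊢
    have := hbet y hxy hyx
    have h2 : FCDiagram.joinOp x b f y = f y := by
      unfold FCDiagram.joinOp
      grind
    rwa [h2]
  by_cases hxb : x = b
  · subst hxb
    have h1 : FCDiagram.joinOp a x f x = a := by simp [FCDiagram.joinOp, hab.ne']
    omega
  have kya := hp.chords hi y a
  have kyb := hp.chords hi y b
  have by' := bet y
  have iya : f y = f a → y = a := hf.inj
  have iyb : f y = f b → y = b := hf.inj
  have jya : f y = a → y = f a := hf.eq_iff.1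
  have jyb : f y = b → y = f b := hf.eq_iff.1
  have jya' : y = f a → f y = a := hf.eq_iff.2
  have jyb' : y = f b → f y = b := hf.eq_iff.2
  unfold FCDiagram.joinOp at *
  by_cases hxfa : x = f a
  · subst hxfa
    clear bet hbet
    simp only [hxa, hxb, if_false, if_true] at hyx ⊢
    split_ifs <;> omega
  by_cases hxfb : x = f b
  · subst hxfb
    clear bet hbet
    simp only [hxa, hxb, hxfa, if_false, if_true] at hyx ⊢
    split_ifs <;> omega
  · simp only [hxa, hxb, hxfa, hxfb, if_false] at hyx ⊢
    have bx := bet x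
    have jxa : f x = a → x = f a := hf.eq_iff.1
    have jxb : f x = b → x = f b := hf.eq_iff.1
    have kxa := (hp.chords hi x a).1
    have kxb := (hp.chords hi x b).1
    clear bet hbet kya kyb by' iya iyb jya jyb jya' jyb' kab ba bb
    -- A join that avoids `a` and `b` cannot separate them, since it lies wholly inside or wholly
    -- outside the interval.
    have key : (x < a ∧ a < f x) ↔ (x < b ∧ b < f x) := by
      clear kxa kxb
      omega
    split_ifs with h1 h2 h3 h4
    · subst h1
      exact key.1 ⟨hxy, hyx⟩
    · subst h2
      exact key.2 ⟨hxy, hyx⟩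
    · subst h3
      have := key.1 (kxa.2 hxy hyx)
      exact kxb.1 this.1 this.2
    · subst h4
      have := key.2 (kxb.2 hxy hyx)
      exact kxa.1 this.1 this.2
    · exact hp x y hxy hyx

/-- This and the next three lemmas are the Temperley–Lieb relations with the powers of `δ` left out.
-/
theorem joinOp_joinOp_joinOp' {N : ℤ} {f : ℤ → ℤ} (hf : IsMatching N f) {a b c : ℤ} (hab : a ≠ b)
    (hbc : b ≠ c) (hac : a ≠ c) :
    joinOp b c (joinOp a b (joinOp b c f)) = joinOp b c f := by
  have hi := hf.invol
  have hinj : ∀ x y, f x = f y → x = y := fun x y => hf.inj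
  funext z
  unfold joinOp
  grind

theorem joinOp_self {N : ℤ} {f : ℤ → ℤ} (hf : IsMatching N f) {a b : ℤ} (hab : a ≠ b) :
    joinOp a b (joinOp a b f) = joinOp a b f := by
  have hi := hf.invol
  have hinj : ∀ x y, f x = f y → x = y := fun x y => hf.inj
  funext z
  unfold joinOp
  grind

theorem joinOp_joinOp_joinOp {N : ℤ} {f : ℤ → ℤ} (hf : IsMatching N f) {a b c : ℤ} (hab : a ≠ b)
    (hbc : b ≠ c) (hac : a ≠ c) :
    joinOp a b (joinOp b c (joinOp a b f)) = joinOp a b f := by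
  have hi := hf.invol
  have hinj : ∀ x y, f x = f y → x = y := fun x y => hf.inj
  funext z
  unfold joinOp
  grind

theorem joinOp_comm {N : ℤ} {f : ℤ → ℤ} (hf : IsMatching N f) {a b c d : ℤ} (hab : a ≠ b)
    (hac : a ≠ c) (had : a ≠ d) (hbc : b ≠ c) (hbd : b ≠ d) (hcd : c ≠ d) (ha : a ≠ 0)
    (hb : b ≠ 0) (hc : c ≠ 0) (hd : d ≠ 0) :
    joinOp a b (joinOp c d f) = joinOp c d (joinOp a b f) := by
  have hi := hf.invol
  have hinj : ∀ x y, f x = f y → x = y := fun x y => hf.inj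
  have h1 := hf.ne a ha
  have h2 := hf.ne b hb
  have h3 := hf.ne c hc
  have h4 := hf.ne d hd
  funext z
  unfold joinOp
  grind (splits := 30)

theorem circleCount_comm {N : ℤ} {f : ℤ → ℤ} (hf : IsMatching N f) {a c : ℤ}
    (h1 : a ≠ c) (h2 : a + 1 ≠ c) (h3 : c + 1 ≠ a) (ha : 0 < a) (hc : 0 < c) :
    circleCount f a + circleCount (joinOp a (a + 1) f) c =
      circleCount f c + circleCount (joinOp c (c + 1) f) a := by
  have hi := hf.invol
  have hinj : ∀ x y, f x = f y → x = y := fun x y => hf.inj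
  have n1 := hf.ne a (by omega)
  have n2 := hf.ne (a + 1) (by omega)
  have n3 := hf.ne c (by omega)
  have n4 := hf.ne (c + 1) (by omega)
  unfold circleCount joinOp
  grind (splits := 30)

/-- If `b` is joined with `c`, then moving the join to `a, b` is undone by moving it back. -/
theorem joinOp_joinOp_of_eq {N : ℤ} {f : ℤ → ℤ} (hf : IsMatching N f) {a b c : ℤ} (hab : a ≠ b)
    (hbc : b ≠ c) (hac : a ≠ c) (h : f b = c) :
    joinOp b c (joinOp a b f) = f := by
  have hi := hf.invol
  have hinj : ∀ x y, f x = f y → x = y := fun x y => hf.inj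
  funext z
  unfold joinOp
  grind

end FCDiagram

/-! ### Effect of generators and blocks on tails and heads -/

namespace FCDiagram

open Relation

/-- `x` is the tail of a join of `AD ∪ D⁺`. -/
def IsTail (f : ℤ → ℤ) (x : ℤ) : Prop := f (-x) < -x ∨ x < f (-x)

/-- `y'` is the head of a join of `BD ∪ D⁺`. -/
def IsHead (f : ℤ → ℤ) (y : ℤ) : Prop := -y < f y ∧ f y < y

section Letters

variable {N : ℤ} {f : ℤ → ℤ}

/-- As `i + 1` is not a head, its partner is at most `-(i + 1)` or beyond `i + 1`. The top dot `i`,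
formerly on a vertical string, inherits this partner and becomes a tail; the status of the partner
itself is unaffected. -/
theorem isTail_joinOp_start (hf : IsMatching N f) {i : ℤ} (hi : 0 < i) (hid : f i = -i)
    (hh : ¬ IsHead f (i + 1)) {x : ℤ} (hx : 0 < x) :
    IsTail (joinOp i (i + 1) f) x ↔ IsTail f x ∨ x = i := by
  have hinv := hf.invol
  have h1 : f (-i) = i := by rw [← hid, hinv]
  have h2 := hf.ne (i + 1) (by omega)
  have h4 := hinv (i + 1)
  have h5 : f (i + 1) ≠ i := fun h => by rw [← h, hinv] at hid; omega
  have h6 : f (i + 1) ≠ -i := fun h => by rw [← h, hinv] at h1; omega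
  unfold IsHead at hh
  unfold IsTail joinOp
  rw [hid]
  by_cases hxi : x = i
  · subst hxi
    simp; omega
  by_cases hxz : -x = f (i + 1)
  · rw [hxz, h4]
    simp; omega
  · have : -x ≠ i := by omega
    have : -x ≠ i + 1 := by omega
    have : -x ≠ -i := by omega
    simp [*]

theorem isHead_joinOp_start (hf : IsMatching N f) {i : ℤ} (hi : 0 < i) (hid : f i = -i)
    (hh : ¬ IsHead f (i + 1)) {y : ℤ} (hy : 0 < y) :
    IsHead (joinOp i (i + 1) f) y ↔ IsHead f y ∨ y = i + 1 := by
  have hinv := hf.invol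
  have h1 : f (-i) = i := by rw [← hid, hinv]
  have h2 := hf.ne (i + 1) (by omega)
  have h4 := hinv (i + 1)
  have h5 : f (i + 1) ≠ i := fun h => by rw [← h, hinv] at hid; omega
  have h6 : f (i + 1) ≠ -i := fun h => by rw [← h, hinv] at h1; omega
  unfold IsHead at hh
  unfold IsHead joinOp
  by_cases hyi : y = i
  · subst hyi
    simp [hid]
  by_cases hyi' : y = i + 1
  · subst hyi'
    simp; omega
  by_cases hyz : y = f (i + 1)
  · rw [hid, hyz, h4]
    simp; omega
  · have : y ≠ -i := by omega
    simp [*]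

/-- The bottom join `k, k + 1` slides to `k + 1, k + 2`, and `k` inherits the partner of `k + 2`,
which lies at most at `-(k + 2)` or beyond `k + 2`. So only the head moves, from `k + 1` to `k + 2`.
-/
theorem isTail_joinOp_slide (hf : IsMatching N f) {k : ℤ} (hk : 0 < k) (hc : f k = k + 1)
    (hh : ¬ IsHead f (k + 2)) {x : ℤ} (hx : 0 < x) :
    IsTail (joinOp (k + 1) (k + 2) f) x ↔ IsTail f x := by
  have hinv := hf.invol
  have h1 : f (k + 1) = k := by rw [← hc, hinv]
  have h2 := hf.ne (k + 2) (by omega)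
  have h4 := hinv (k + 2)
  have h5 : f (k + 2) ≠ k := fun h => by rw [← h, hinv] at hc; omega
  have h6 : f (k + 2) ≠ k + 1 := fun h => by rw [← h, hinv] at h1; omega
  unfold IsHead at hh
  unfold IsTail joinOp
  by_cases hxz : -x = f (k + 2)
  · rw [hxz, h4, h1]
    simp; omega
  · have : -x ≠ k := by omega
    have : -x ≠ k + 1 := by omega
    have : -x ≠ k + 2 := by omega
    simp [*]

theorem isHead_joinOp_slide (hf : IsMatching N f) {k : ℤ} (hk : 0 < k) (hc : f k = k + 1)
    (hh : ¬ IsHead f (k + 2)) {y : ℤ} (hy : 0 < y) :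
    IsHead (joinOp (k + 1) (k + 2) f) y ↔ IsHead f y ∧ y ≠ k + 1 ∨ y = k + 2 := by
  have hinv := hf.invol
  have h1 : f (k + 1) = k := by rw [← hc, hinv]
  have h2 := hf.ne (k + 2) (by omega)
  have h4 := hinv (k + 2)
  have h5 : f (k + 2) ≠ k := fun h => by rw [← h, hinv] at hc; omega
  have h6 : f (k + 2) ≠ k + 1 := fun h => by rw [← h, hinv] at h1; omega
  unfold IsHead at hh
  unfold IsHead joinOp
  by_cases hyi : y = k + 1
  · subst hyi
    simp
  by_cases hyi' : y = k + 2
  · subst hyi'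
    simp; omega
  by_cases hyk : y = k
  · subst hyk
    simp [h1, hc]; omega
  by_cases hyz : y = f (k + 2)
  · rw [hyz, h4, h1]
    simp; omega
  · simp [*]

end Letters

/-! ### The action of words -/

section Words

variable {n : ℕ}

/-- The right action of a generator on the pairs `(m, f)`, which stand for `δ ^ m • f`. -/
def genAct (P : ℕ × (ℤ → ℤ)) (k : Fin n) : ℕ × (ℤ → ℤ) :=
  (P.1 + circleCount P.2 (k + 1), joinOp (k + 1) (k + 1 + 1) P.2)

/-- The right action of a word. -/
def wordAct (P : ℕ × (ℤ → ℤ)) (ω : List (Fin n)) : ℕ × (ℤ → ℤ) := ω.foldl genAct P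

theorem wordAct_append (P : ℕ × (ℤ → ℤ)) (ω ω' : List (Fin n)) :
    wordAct P (ω ++ ω') = wordAct (wordAct P ω) ω' := List.foldl_append

theorem isMatching_genAct {P : ℕ × (ℤ → ℤ)} (hP : IsMatching (n + 1) P.2) (k : Fin n) :
    IsMatching (n + 1) (genAct P k).2 := by
  have hk := k.isLt
  apply hP.joinOp
  · omega
  · omega
  · omega
  · rw [abs_le]; omega
  · rw [abs_le]; omega

theorem isMatching_wordAct {P : ℕ × (ℤ → ℤ)} (hP : IsMatching (n + 1) P.2) (ω : List (Fin n)) :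
    IsMatching (n + 1) (wordAct P ω).2 := by
  induction ω generalizing P with
  | nil => exact hP
  | cons k ω ih => exact ih (isMatching_genAct hP k)

theorem wordAct_snd_eq {P Q : ℕ × (ℤ → ℤ)} (h : P.2 = Q.2) (ω : List (Fin n)) :
    (wordAct P ω).2 = (wordAct Q ω).2 := by
  induction ω generalizing P Q with
  | nil => exact h
  | cons k ω ih => exact ih (by simp [genAct, h])

theorem wordAct_eq_of_commStep {P : ℕ × (ℤ → ℤ)} (hP : IsMatching (n + 1) P.2)
    {ω ω' : List (Fin n)} (h : CommStep (CoxeterMatrix.A n) ω ω') :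
    wordAct P ω = wordAct P ω' := by
  obtain ⟨l, r, s, t, hst, rfl, rfl⟩ := h
  rw [typeA_eq_two_iff] at hst
  simp only [wordAct_append]
  congr 1
  have hm := isMatching_wordAct hP l
  generalize wordAct P l = Q at hm
  refine Prod.ext ?_ ?_
  · have := circleCount_comm hm (a := (s : ℕ) + 1) (c := (t : ℕ) + 1) (by omega) (by omega)
      (by omega) (by omega) (by omega)
    simp only [wordAct, List.foldl_cons, List.foldl_nil, genAct]
    omega
  · simp only [wordAct, List.foldl_cons, List.foldl_nil, genAct]
    apply joinOp_comm hm <;> omega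

theorem wordAct_eq_of_reflTransGen {P : ℕ × (ℤ → ℤ)} (hP : IsMatching (n + 1) P.2)
    {ω ω' : List (Fin n)} (h : ReflTransGen (CommStep (CoxeterMatrix.A n)) ω ω') :
    wordAct P ω = wordAct P ω' := by
  induction h with
  | refl => rfl
  | tail _ h ih => exact ih.trans (wordAct_eq_of_commStep hP h)

/-- The first letter creates the tail `i` and the head `i + 1`; each later letter slides that head
one step right. The join `j, j + 1` is the invariant that permits the next slide, and the vertical
strings left of `i` are what the next block needs. -/
theorem wordAct_block {P : ℕ × (ℤ → ℤ)} (hP : IsMatching (n + 1) P.2) {i j : ℕ} (hi : 1 ≤ i)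
    (hij : i ≤ j) (hj : j ≤ n) (hid : P.2 i = -i)
    (hh : ∀ y : ℤ, (i : ℤ) < y → y ≤ j + 1 → ¬ IsHead P.2 y) :
    (wordAct P (block n i j)).1 = P.1 ∧
    (wordAct P (block n i j)).2 j = j + 1 ∧
    (∀ x : ℤ, 0 < x → (IsTail (wordAct P (block n i j)).2 x ↔ IsTail P.2 x ∨ x = i)) ∧
    (∀ y : ℤ, 0 < y → (IsHead (wordAct P (block n i j)).2 y ↔ IsHead P.2 y ∨ y = j + 1)) ∧
    ∀ x : ℤ, 0 < x → x < i → P.2 x = -x → (wordAct P (block n i j)).2 x = -x := by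
  induction j, hij using Nat.le_induction with
  | base =>
    obtain ⟨m, rfl⟩ : ∃ m, i = m + 1 := ⟨i - 1, by omega⟩
    have hb := block_self (⟨m, by omega⟩ : Fin n)
    simp only at hb
    rw [hb]
    have hs : ¬ IsHead P.2 ((m + 1 : ℕ) + 1) := hh _ (by omega) (by omega)
    push_cast at hid hs ⊢
    refine ⟨?_, ?_, ?_, ?_, ?_⟩
    · simp only [wordAct, List.foldl_cons, List.foldl_nil, genAct, circleCount, hid]
      rw [if_neg (by omega)]; simp
    · simp only [wordAct, List.foldl_cons, List.foldl_nil, genAct, joinOp, if_true]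
    · intro x hx
      exact isTail_joinOp_start hP (by omega) hid hs hx
    · intro x hx
      exact isHead_joinOp_start hP (by omega) hid hs hx
    · intro x hx hxi hfx
      have h1 : x ≠ P.2 ((m : ℤ) + 1 + 1) := by
        intro h
        rw [h, hP.invol] at hfx; omega
      simp only [wordAct, List.foldl_cons, List.foldl_nil, genAct, joinOp, hid]
      rw [if_neg (by omega), if_neg (by omega), if_neg (by omega), if_neg h1, hfx]
  | succ j hij ih =>
    obtain ⟨h1, h2, h3, h4, h5⟩ := ih (by omega) (fun y hy hy' => hh y hy (by push_cast; omega))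
    have hjn : j < n := hj
    rw [block_split (⟨j, hjn⟩ : Fin n) (by simp only; omega) le_rfl,
      block_eq_nil (i := (⟨j, _⟩ : Fin n) + 2) (by simp only; omega), List.append_nil,
      wordAct_append]
    simp only
    have hm := isMatching_wordAct hP (block n i j)
    generalize wordAct P (block n i j) = Q at *
    have hs : ¬ IsHead Q.2 ((j : ℤ) + 2) := by
      rw [h4 _ (by omega)]
      have := hh ((j : ℤ) + 2) (by omega) (by push_cast; omega)
      simp [this]
    have hj1 : Q.2 ((j : ℤ) + 1) = j := by rw [← h2, hm.invol]
    have e : (j : ℤ) + 1 + 1 = j + 2 := by ring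
    push_cast
    simp only [wordAct, List.foldl_cons, List.foldl_nil, genAct, e]
    refine ⟨?_, ?_, ?_, ?_, ?_⟩
    · simp only [circleCount, hj1]
      rw [if_neg (by omega)]; simpa using h1
    · simp [joinOp]
    · intro x hx
      rw [← h3 x hx]
      exact isTail_joinOp_slide hm (by omega) h2 hs hx
    · intro y hy
      rw [isHead_joinOp_slide hm (by omega) h2 hs hy, h4 y hy]
      have hn : ¬ IsHead P.2 ((j : ℤ) + 1) := hh _ (by omega) (by push_cast; omega)
      by_cases hyj : y = (j : ℤ) + 1
      · subst hyj
        simp [hn]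
      · simp [hyj]
    · intro x hx hxi hfx
      have hQ := h5 x hx hxi hfx
      have h1 : x ≠ Q.2 ((j : ℤ) + 2) := by
        intro h
        rw [h, hm.invol] at hQ; omega
      simp only [joinOp, hj1]
      rw [if_neg (by omega), if_neg (by omega), if_neg (by omega), if_neg h1, hQ]

/-- Decreasing starts leave the string at the next start vertical, and decreasing ends keep all
earlier heads to the right of the next one, so `wordAct_block` applies to every block. -/
theorem wordAct_normalWord {L : List (ℕ × ℕ)} (hL : IsNormal n L) :
    (wordAct (0, fun z => -z) (normalWord n L)).1 = 0 ∧
    (∀ x : ℤ, 0 < x → (IsTail (wordAct (0, fun z => -z) (normalWord n L)).2 x ↔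
      ∃ q ∈ L, x = (q.1 : ℕ))) ∧
    (∀ y : ℤ, 0 < y → (IsHead (wordAct (0, fun z => -z) (normalWord n L)).2 y ↔
      ∃ q ∈ L, y = (q.2 : ℕ) + 1)) ∧
    ∀ x : ℤ, 0 < x → (∀ q ∈ L, x < (q.1 : ℕ)) →
      (wordAct (0, fun z => -z) (normalWord n L)).2 x = -x := by
  induction L using List.reverseRecOn with
  | nil =>
    simp [normalWord, wordAct, IsTail, IsHead]
    intro x hx
    omega
  | append_singleton L q ih =>
    rw [isNormal_append_singleton] at hL
    obtain ⟨hL, hq, hq1, hq2, hq3⟩ := hL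
    obtain ⟨h1, h2, h3, h4⟩ := ih hL
    rw [normalWord_append, normalWord_singleton, wordAct_append]
    have hm := isMatching_wordAct (P := (0, fun z => -z)) (isMatching_neg (n + 1)) (normalWord n L)
    generalize wordAct (0, fun z => -z) (normalWord n L) = Q at *
    obtain ⟨g1, -, g2, g3, g4⟩ := wordAct_block hm hq1 hq2 hq3
      (h4 _ (by omega) fun r hr => by have := hq r hr; omega)
      (fun y hy hy' hh => by
        obtain ⟨r, hr, hry⟩ := (h3 y (by omega)).1 hh
        have := hq r hr
        omega)
    refine ⟨g1.trans h1, ?_, ?_, ?_⟩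
    · intro x hx
      rw [g2 x hx, h2 x hx]
      simp [or_and_right, exists_or]
    · intro x hx
      rw [g3 x hx, h3 x hx]
      simp [or_and_right, exists_or]
    · intro x hx hall
      exact g4 x hx (hall q (by simp)) (h4 x hx fun r hr => hall r (by simp [hr]))

end Words

end FCDiagram

namespace FCDiagram

open Relation

/-! ### Planar matchings are products of generators -/

section Planar

variable {N : ℤ} {f : ℤ → ℤ}

/-- An innermost join inside the given one has adjacent endpoints. -/
theorem IsPlanar.exists_cup_of_arc (hf : IsMatching N f) (hp : IsPlanar f) {a : ℤ} (ha : 0 < a)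
    (h : a < f a) : ∃ k, a ≤ k ∧ f k = k + 1 := by
  obtain ⟨d, hd⟩ : ∃ d : ℕ, f a = a + 1 + d := ⟨(f a - a - 1).toNat, by omega⟩
  induction d using Nat.strong_induction_on generalizing a with
  | _ d ih =>
    by_cases h0 : d = 0
    · exact ⟨a, le_rfl, by omega⟩
    have h1 := hp a (a + 1) (by omega) (by omega)
    have h2 := hf.ne (a + 1) (by omega)
    obtain ⟨k, hk, hk'⟩ := ih (f (a + 1) - (a + 1) - 1).toNat (by omega) (a := a + 1) (by omega)
      (by omega) (by omega)
    exact ⟨k, by omega, hk'⟩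

theorem IsPlanar.exists_cup (hf : IsMatching N f) (hp : IsPlanar f) {m : ℤ} (hm : 0 < m)
    (hid : ∀ x, 0 < x → x < m → f x = -x) (hne : f m ≠ -m) :
    ∃ k, m ≤ k ∧ k + 1 ≤ N ∧ f k = k + 1 := by
  have hk : ∃ k, m ≤ k ∧ f k = k + 1 := by
    have hge : ∀ y, m ≤ y → f y ≤ -m ∨ m ≤ f y := by
      intro y hy
      by_contra hc
      push Not at hc
      have h0 := hf.apply_ne_zero (z := y) (by omega)
      rcases lt_or_gt_of_ne h0 with h | h
      · have := hid (-f y) (by omega) (by omega)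
        rw [neg_neg] at this
        have := hf.inj this
        omega
      · have := hid (f y) h (by omega)
        rw [hf.invol] at this
        omega
    by_contra hc
    have harc : ∀ y, m ≤ y → f y ≤ -m := by
      intro y hy
      by_contra hlt
      have h1 : m ≤ f y := (hge y hy).resolve_left hlt
      have h2 := hf.ne y (by omega)
      rcases lt_or_gt_of_ne h2 with h | h
      · obtain ⟨k, hk1, hk2⟩ := hp.exists_cup_of_arc hf (a := f y) (by omega)
          (by rw [hf.invol]; exact h)
        exact hc ⟨k, by omega, hk2⟩
      · obtain ⟨k, hk1, hk2⟩ := hp.exists_cup_of_arc hf (a := y) (by omega) h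
        exact hc ⟨k, by omega, hk2⟩
    have hmN : m ≤ N := by
      by_contra h
      exact hne (hf.out m (by rw [abs_of_pos hm]; omega))
    -- Without a bottom join beyond `m`, counting makes `f` a bijection between these intervals. So
    -- `-m` is joined to some `y > m`, and the join of `m` would have to cross it.
    have himg : (Finset.Icc m N).image f = Finset.Icc (-N) (-m) := by
      apply Finset.eq_of_subset_of_card_le
      · intro z hz
        rw [Finset.mem_image] at hz
        obtain ⟨y, hy, rfl⟩ := hz
        rw [Finset.mem_Icc] at hy ⊢
        have := hf.abs_apply_le (z := y) (by rw [abs_le]; omega)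
        rw [abs_le] at this
        exact ⟨this.1, harc y hy.1⟩
      · rw [Finset.card_image_of_injective _ fun a b => hf.inj]
        simp
        omega
    have hmem : -m ∈ (Finset.Icc m N).image f := by
      rw [himg, Finset.mem_Icc]; omega
    rw [Finset.mem_image] at hmem
    obtain ⟨y, hy, hym⟩ := hmem
    rw [Finset.mem_Icc] at hy
    rcases hy.1.eq_or_lt with h | h
    · rw [← h] at hym
      exact hne hym
    · have h1 : f (-m) = y := by rw [← hym, hf.invol]
      have h2 := hp (-m) m (by omega) (by omega)
      have := harc m le_rfl
      omega
  obtain ⟨k, hk, hk'⟩ := hk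
  refine ⟨k, hk, ?_, hk'⟩
  have hkN : k ≤ N := by
    by_contra h
    have := hf.out k (by rw [abs_of_pos (by omega)]; omega)
    omega
  have := hf.abs_apply_le (z := k) (by rw [abs_le]; omega)
  rw [abs_le] at this
  omega

end Planar

variable {n : ℕ}

theorem wordAct_append_singleton_snd {f g : ℤ → ℤ} {ω : List (Fin n)}
    (h : (wordAct (0, fun z => -z) ω).2 = g) {k : ℤ} (hk : 0 < k) (hkn : k < n + 1)
    (hfg : joinOp k (k + 1) g = f) :
    ∃ ω : List (Fin n), (wordAct (0, fun z => -z) ω).2 = f := by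
  obtain ⟨a, rfl⟩ : ∃ a : ℕ, k = a + 1 := ⟨(k - 1).toNat, by omega⟩
  refine ⟨ω ++ [⟨a, by omega⟩], ?_⟩
  rw [wordAct_append, ← hfg, ← h]
  rfl

/-- Generators are peeled off from the right. With the strings left of `m` vertical and `m` not,
there is a bottom join `k, k + 1` with `k ≥ m`; it is slid left until `k = m` and then opened, which
makes the string `m` vertical. The induction is on the number of strings left, then on `k - m`. -/
theorem exists_wordAct_eq {f : ℤ → ℤ} (hf : IsMatching (n + 1) f) (hp : IsPlanar f) :
    ∃ ω : List (Fin n), (wordAct (0, fun z => -z) ω).2 = f := by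
  have main : ∀ (d : ℕ) (m : ℤ), 0 < m → m + d = n + 2 → ∀ f : ℤ → ℤ, IsMatching (n + 1) f →
      IsPlanar f → (∀ x, 0 < x → x < m → f x = -x) →
      ∃ ω : List (Fin n), (wordAct (0, fun z => -z) ω).2 = f := by
    intro d
    induction d with
    | zero =>
      intro m hm hmd f hf hp hid
      refine ⟨[], ?_⟩
      have hpos : ∀ x, 0 < x → f x = -x := by
        intro x hx
        rcases lt_or_ge x m with h | h
        · exact hid x hx h
        · exact hf.out x (by rw [abs_of_pos hx]; omega)
      funext z
      rcases lt_trichotomy z 0 with h | h | h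
      · symm
        rw [hf.eq_iff]
        change z = f (-z)
        rw [hpos (-z) (by omega)]; omega
      · subst h
        rw [hf.zero]; rfl
      · rw [hpos z h]; rfl
    | succ d ih =>
      intro m hm hmd f hf hp hid
      push_cast at hmd
      by_cases hfm : f m = -m
      · refine ih (m + 1) (by omega) (by omega) f hf hp ?_
        intro x hx hxm
        rcases (show x ≤ m by omega).eq_or_lt with h | h
        · rw [h]; exact hfm
        · exact hid x hx h
      obtain ⟨k, hmk, hkN, hk⟩ := hp.exists_cup hf hm hid hfm
      clear hfm
      obtain ⟨e, he⟩ : ∃ e : ℕ, k = m + e := ⟨(k - m).toNat, by omega⟩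
      induction e generalizing k f with
      | zero =>
        obtain rfl : k = m := by omega
        have hneg : ∀ c, -k < c → c < k → f c = -c := by
          intro c h1 h2
          rcases lt_trichotomy c 0 with h | h | h
          · rw [hf.eq_iff, hid (-c) (by omega) (by omega)]; omega
          · rw [h, hf.zero]; rfl
          · exact hid c h h2
        -- Restoring the vertical string at `k` is undone by `E_k`, because `k` was joined with `k +
        -- 1`.
        obtain ⟨ω, hω⟩ := ih (k + 1) (by omega) (by omega) (joinOp (-k) k f)
          (hf.joinOp (by omega) (by omega) (by omega) (by rw [abs_le]; omega)
            (by rw [abs_le]; omega))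
          (hp.joinOp hf (by omega) (by omega) (by omega) (fun c h1 h2 => by
            rw [hneg c h1 h2]; omega))
          (fun x hx hxk => by
            rcases (show x ≤ k by omega).eq_or_lt with h | h
            · subst h
              simp only [joinOp, if_true]
              rw [if_neg (by omega)]
            · have h1 := hid x hx h
              have h2 : x ≠ f (-k) := fun h' => by rw [h', hf.invol] at h1; omega
              unfold joinOp
              rw [if_neg (by omega), if_neg (by omega), if_neg h2, if_neg (by omega), h1])
        exact wordAct_append_singleton_snd hω hm (by omega)
          (joinOp_joinOp_of_eq hf (by omega) (by omega) (by omega) hk)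
      | succ e ihe =>
        push_cast at he
        -- The slide from `k, k + 1` to `k - 1, k` is undone by `E_k`.
        obtain ⟨ω, hω⟩ := ihe (joinOp (k - 1) k f)
          (hf.joinOp (by omega) (by omega) (by omega) (by rw [abs_le]; omega)
            (by rw [abs_le]; omega))
          (hp.joinOp hf (by omega) (by omega) (by omega) (fun c h1 h2 => by omega))
          (fun x hx hxm => by
            have h1 := hid x hx hxm
            have h2 : x ≠ f (k - 1) := fun h' => by rw [h', hf.invol] at h1; omega
            unfold joinOp
            rw [if_neg (by omega), if_neg (by omega), if_neg h2, if_neg (by omega), h1])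
          (k - 1) (by omega) (by omega) (by simp [joinOp]) (by omega)
        exact wordAct_append_singleton_snd hω (by omega) (by omega)
          (joinOp_joinOp_of_eq hf (by omega) (by omega) (by omega) hk)
  exact main (n + 1) 1 (by omega) (by push_cast; ring) f hf hp (fun x h1 h2 => by omega)

/-- Every planar matching is the product along a normal word. -/
theorem exists_isNormal_wordAct_eq {f : ℤ → ℤ} (hf : IsMatching (n + 1) f) (hp : IsPlanar f) :
    ∃ L, IsNormal n L ∧ wordAct (0, fun z => -z) (normalWord n L) = (0, f) := by
  classical
  have hex : ∃ l : ℕ, ∃ ω : List (Fin n), ω.length = l ∧ (wordAct (0, fun z => -z) ω).2 = f := by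
    obtain ⟨ω, hω⟩ := exists_wordAct_eq hf hp
    exact ⟨_, ω, rfl, hω⟩
  obtain ⟨ω, hl, hω⟩ := Nat.find_spec hex
  -- Minimality ignores circles, so `s s → s` and `s t s → s` both contradict it and `ω` is good.
  -- That no circle occurs is recovered at the end from the normal word.
  have hmin : ∀ ω' : List (Fin n), (wordAct (0, fun z => -z) ω').2 = f → ω.length ≤ ω'.length := by
    intro ω' h
    rw [hl]
    exact Nat.find_min' hex ⟨ω', rfl, h⟩
  have hneg : IsMatching ((n : ℤ) + 1) ((0 : ℕ), fun z : ℤ => -z).2 := isMatching_neg _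
  have hgood : IsGood (CoxeterMatrix.A n) ω := by
    intro ω' hc
    have hlen := (perm_of_reflTransGen_commStep hc).length_eq
    rw [wordAct_eq_of_reflTransGen hneg hc] at hω
    constructor
    · rintro s ⟨l, r, rfl⟩
      have := hmin (l ++ [s] ++ r) (by
        rw [← hω]
        simp only [wordAct_append]
        apply wordAct_snd_eq
        exact (joinOp_self (isMatching_wordAct hneg l) (by omega)).symm)
      simp at this hlen
      omega
    · rintro s t hst ⟨l, r, rfl⟩
      have := hmin (l ++ [s] ++ r) (by
        rw [← hω]
        simp only [wordAct_append]
        apply wordAct_snd_eq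
        have hm := isMatching_wordAct hneg l
        generalize wordAct (0, fun z => -z) l = Q at hm
        rw [typeA_eq_three_iff] at hst
        simp only [wordAct, List.foldl_cons, List.foldl_nil, genAct]
        rcases hst with hst | hst
        · rw [← hst]
          push_cast
          exact (joinOp_joinOp_joinOp hm (by omega) (by omega) (by omega)).symm
        · rw [← hst]
          push_cast
          exact (joinOp_joinOp_joinOp' hm (by omega) (by omega) (by omega)).symm)
      simp at this hlen
      omega
  obtain ⟨L, hL, hc⟩ := hgood.exists_isNormal
  refine ⟨L, hL, ?_⟩
  rw [wordAct_eq_of_reflTransGen hneg hc] at hω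
  exact Prod.ext (wordAct_normalWord hL).1 hω

end FCDiagram

namespace FCDiagram

variable {n : ℕ}

/-! ### Diagrams and matchings -/

/-- The coordinate of a dot. -/
def coord (d : Dot n) : ℤ :=
  Sum.elim (fun x : Fin (n + 1) => -((x : ℕ) + 1 : ℤ)) (fun x : Fin (n + 1) => (x : ℕ) + 1) (ofLex d)

@[simp] theorem coord_top (x : Fin (n + 1)) : coord (top x) = -((x : ℕ) + 1 : ℤ) := rfl

@[simp] theorem coord_bot (x : Fin (n + 1)) : coord (bot x) = (x : ℕ) + 1 := rfl

theorem dot_cases (d : Dot n) : (∃ x, d = top x) ∨ ∃ x, d = bot x := by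
  rcases h : ofLex d with x | x
  · exact Or.inl ⟨x, by rw [top, Sum.inlₗ, ← h]; rfl⟩
  · exact Or.inr ⟨x, by rw [bot, Sum.inrₗ, ← h]; rfl⟩

theorem coord_injective : Function.Injective (coord : Dot n → ℤ) := by
  intro d e h
  rcases dot_cases d with ⟨x, rfl⟩ | ⟨x, rfl⟩ <;> rcases dot_cases e with ⟨y, rfl⟩ | ⟨y, rfl⟩ <;>
    simp only [coord_top, coord_bot] at h
  · rw [show x = y from Fin.ext (by omega)]
  · omega
  · omega
  · rw [show x = y from Fin.ext (by omega)]

theorem coord_ne_zero (d : Dot n) : coord d ≠ 0 := by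
  rcases dot_cases d with ⟨x, rfl⟩ | ⟨x, rfl⟩ <;> simp only [coord_top, coord_bot] <;> omega

theorem abs_coord_le (d : Dot n) : |coord d| ≤ n + 1 := by
  rw [abs_le]
  rcases dot_cases d with ⟨x, rfl⟩ | ⟨x, rfl⟩ <;> simp only [coord_top, coord_bot] <;> omega

theorem exists_coord_eq {z : ℤ} (hz : z ≠ 0) (hzn : |z| ≤ n + 1) : ∃ d : Dot n, coord d = z := by
  rw [abs_le] at hzn
  rcases lt_or_gt_of_ne hz with h | h
  · exact ⟨top ⟨(-z - 1).toNat, by omega⟩, by simp only [coord_top]; omega⟩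
  · exact ⟨bot ⟨(z - 1).toNat, by omega⟩, by simp only [coord_bot]; omega⟩

theorem exists_coord_eq_apply {f : ℤ → ℤ} (hf : IsMatching (n + 1) f) (d : Dot n) :
    ∃ e : Dot n, f (coord d) = coord e := by
  obtain ⟨e, he⟩ := exists_coord_eq (hf.apply_ne_zero (coord_ne_zero d))
    (hf.abs_apply_le (abs_coord_le d))
  exact ⟨e, he.symm⟩

/-- The diagram of a matching. -/
def toDiag (n : ℕ) (f : ℤ → ℤ) : Set (Dot n × Dot n) :=
  {a | a.1 < a.2 ∧ f (coord a.1) = coord a.2}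

theorem top_lt_top {x y : Fin (n + 1)} : (top x : Dot n) < top y ↔ x < y := Sum.Lex.inl_lt_inl_iff

theorem bot_lt_bot {x y : Fin (n + 1)} : (bot x : Dot n) < bot y ↔ x < y := Sum.Lex.inr_lt_inr_iff

theorem top_lt_bot (x y : Fin (n + 1)) : (top x : Dot n) < bot y := Sum.Lex.inl_lt_inr _ _

theorem not_bot_lt_top (x y : Fin (n + 1)) : ¬ (bot x : Dot n) < top y := Sum.Lex.not_inr_lt_inl

theorem idDiagram_eq : idDiagram n = toDiag n fun z => -z := by
  ext ⟨d, e⟩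
  simp only [idDiagram, toDiag, Set.mem_ofPred_eq, Prod.mk.injEq]
  constructor
  · rintro ⟨x, rfl, rfl⟩
    exact ⟨top_lt_bot x x, by simp⟩
  · rintro ⟨hlt, h⟩
    rcases dot_cases d with ⟨x, rfl⟩ | ⟨x, rfl⟩ <;> rcases dot_cases e with ⟨y, rfl⟩ | ⟨y, rfl⟩ <;>
      simp only [coord_top, coord_bot] at h
    · omega
    · exact ⟨x, rfl, by rw [show x = y from Fin.ext (by omega)]⟩
    · exact absurd hlt (not_bot_lt_top _ _)
    · omega

/-- The coordinate order is the boundary order reversed and cut at another point, and whether two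
joins cross depends only on the cyclic order up to reversal. -/
theorem IsNonCrossingDiagram.exists_toDiag {D : Set (Dot n × Dot n)} (hD : IsNonCrossingDiagram D) :
    ∃ f, IsMatching (n + 1) f ∧ IsPlanar f ∧ D = toDiag n f := by
  classical
  have hsymm : ∀ u v, Joined D u v → Joined D v u := fun u v h => h.symm
  have hne : ∀ u v, Joined D u v → v ≠ u := by
    rintro u v (h | h) rfl
    · exact lt_irrefl _ (hD.lt _ h)
    · exact lt_irrefl _ (hD.lt _ h)
  have huniq : ∀ u v w, Joined D u v → Joined D u w → v = w := by
    intro u v w hv hw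
    have h := fun a b => (hD.existsUnique u).unique (y₁ := a) (y₂ := b)
    have hvn := hne _ _ hv
    have hwn := hne _ _ hw
    rcases hv with hv | hv <;> rcases hw with hw | hw
    · exact congrArg Prod.snd (h _ _ ⟨hv, Or.inl rfl⟩ ⟨hw, Or.inl rfl⟩)
    · exact absurd (congrArg Prod.snd (h _ _ ⟨hv, Or.inl rfl⟩ ⟨hw, Or.inr rfl⟩)) hvn
    · exact absurd (congrArg Prod.snd (h _ _ ⟨hv, Or.inr rfl⟩ ⟨hw, Or.inl rfl⟩)) hwn.symm
    · exact congrArg Prod.fst (h _ _ ⟨hv, Or.inr rfl⟩ ⟨hw, Or.inr rfl⟩)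
  have hex : ∀ u, ∃ v, Joined D u v := by
    intro u
    obtain ⟨⟨a, b⟩, ⟨hab, h⟩, -⟩ := hD.existsUnique u
    rcases h with rfl | rfl
    · exact ⟨b, Or.inl hab⟩
    · exact ⟨a, Or.inr hab⟩
  choose p hp using hex
  have hpp : ∀ u, p (p u) = u := fun u => huniq _ _ _ (hp (p u)) (hsymm _ _ (hp u))
  have hiff : ∀ u v, (u, v) ∈ D ↔ u < v ∧ p u = v := by
    intro u v
    constructor
    · intro h
      exact ⟨hD.lt _ h, huniq _ _ _ (hp u) (Or.inl h)⟩
    · rintro ⟨hlt, rfl⟩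
      rcases hp u with h | h
      · exact h
      · exact absurd hlt (hD.lt _ h).not_gt
  let f : ℤ → ℤ := fun z => if h : ∃ d : Dot n, coord d = z then coord (p h.choose) else -z
  have hfc : ∀ d, f (coord d) = coord (p d) := by
    intro d
    have h : ∃ e : Dot n, coord e = coord d := ⟨d, rfl⟩
    have : h.choose = d := coord_injective h.choose_spec
    simp only [f, dif_pos h, this]
  have hfo : ∀ z, (¬ ∃ d : Dot n, coord d = z) → f z = -z := by
    intro z h
    simp only [f, dif_neg h]
  have hout : ∀ z : ℤ, (¬ ∃ d : Dot n, coord d = z) → ¬ ∃ d : Dot n, coord d = -z := by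
    intro z h ⟨d, hd⟩
    apply h
    have h1 := coord_ne_zero d
    have h2 := abs_coord_le d
    rw [hd] at h1 h2
    rw [abs_neg] at h2
    exact exists_coord_eq (by omega) h2
  have hfm : IsMatching (n + 1) f := by
    constructor
    · intro z
      by_cases h : ∃ d : Dot n, coord d = z
      · obtain ⟨d, rfl⟩ := h
        rw [hfc, hfc, hpp]
      · rw [hfo z h, hfo _ (hout z h), neg_neg]
    · rw [hfo, neg_zero]
      rintro ⟨d, hd⟩
      exact coord_ne_zero d hd
    · intro z hz
      by_cases h : ∃ d : Dot n, coord d = z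
      · obtain ⟨d, rfl⟩ := h
        rw [hfc]
        exact fun h => hne _ _ (hp d) (coord_injective h)
      · rw [hfo z h]; omega
    · intro z hz
      apply hfo
      rintro ⟨d, rfl⟩
      have := abs_coord_le d
      omega
  have hcross : ∀ u s v t : Dot n, boundaryPos u < boundaryPos s → boundaryPos s < boundaryPos v →
      boundaryPos v < boundaryPos t → (p u = v ∨ p v = u) → (p s = t ∨ p t = s) → False := by
    intro u s v t h1 h2 h3 h4 h5
    refine hD.nonCrossing u s v t h1 h2 h3 ⟨?_, ?_⟩
    · rcases h4 with rfl | rfl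
      · exact hp u
      · exact hsymm _ _ (hp v)
    · rcases h5 with rfl | rfl
      · exact hp s
      · exact hsymm _ _ (hp t)
  have hpos : ∀ d : Dot n, (boundaryPos d : ℤ) =
      if coord d < 0 then -coord d - 1 else 2 * n + 2 - coord d := by
    intro d
    rcases dot_cases d with ⟨x, rfl⟩ | ⟨x, rfl⟩
    · have : boundaryPos (top x : Dot n) = x := rfl
      rw [this, coord_top, if_pos (by omega)]; omega
    · have : boundaryPos (bot x : Dot n) = 2 * n + 1 - x := rfl
      rw [this, coord_bot, if_neg (by omega)]; omega
  have hnc : ∀ u s : Dot n, coord u < coord s → coord s < coord (p u) →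
      ¬ coord (p u) < coord (p s) := by
    intro u s h1 h2 h3
    have e1 := hpos u
    have e2 := hpos s
    have e3 := hpos (p u)
    have e4 := hpos (p s)
    have n1 := coord_ne_zero u
    have n2 := coord_ne_zero s
    have n3 := coord_ne_zero (p u)
    have n4 := coord_ne_zero (p s)
    have b1 := abs_coord_le u
    have b4 := abs_coord_le (p s)
    rw [abs_le] at b1 b4
    by_cases c1 : coord u < 0 <;> by_cases c2 : coord s < 0 <;> by_cases c3 : coord (p u) < 0 <;>
      by_cases c4 : coord (p s) < 0 <;> simp only [c1, c2, c3, c4, if_true, if_false] at e1 e2 e3 e4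
    -- Besides contradictory signs, only the rotation of the four dots varies, according to how many
    -- of them lie in the top row.
    all_goals first
      | omega
      | exact hcross (p s) (p u) s u (by omega) (by omega) (by omega) (Or.inr rfl) (Or.inr rfl)
      | exact hcross (p u) s u (p s) (by omega) (by omega) (by omega) (Or.inr rfl) (Or.inl rfl)
      | exact hcross s u (p s) (p u) (by omega) (by omega) (by omega) (Or.inl rfl) (Or.inl rfl)
      | exact hcross u (p s) (p u) s (by omega) (by omega) (by omega) (Or.inl rfl) (Or.inr rfl)
  refine ⟨f, hfm, ?_, ?_⟩
  · intro a b hab hba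
    by_cases ha : ∃ d : Dot n, coord d = a
    · obtain ⟨u, rfl⟩ := ha
      rw [hfc] at hba ⊢
      by_cases hb0 : b = 0
      · subst hb0
        rw [hfm.zero]
        exact ⟨hab, hba⟩
      have hbn : |b| ≤ n + 1 := by
        have h1 := abs_coord_le u
        have h2 := abs_coord_le (p u)
        rw [abs_le] at h1 h2 ⊢
        omega
      obtain ⟨s, rfl⟩ := exists_coord_eq hb0 hbn
      rw [hfc]
      have h1 := hnc u s hab hba
      have h2 : coord (p s) ≠ coord (p u) := fun h => by
        have := congrArg p (coord_injective h)
        rw [hpp, hpp] at this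
        rw [this] at hab
        omega
      have h3 : coord (p s) ≠ coord u := fun h => by
        have := congrArg p (coord_injective h)
        rw [hpp] at this
        rw [this] at hba
        omega
      refine ⟨?_, by omega⟩
      by_contra h4
      -- If the partner of `s` lies left of `u`, the same crossing is seen from that partner.
      have h5 := hnc (p s) u (by omega) (by rw [hpp]; exact hab)
      rw [hpp] at h5
      exact h5 hba
    · have hfa := hfo a ha
      rw [hfa] at hba ⊢
      have haN : (n : ℤ) + 1 < -a := by
        by_contra h
        exact ha (exists_coord_eq (by omega) (by rw [abs_le]; omega))
      by_cases hb : |b| ≤ n + 1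
      · have := hfm.abs_apply_le hb
        rw [abs_le] at this
        omega
      · rw [hfm.out b (by omega)]
        omega
  · ext ⟨u, v⟩
    rw [hiff]
    simp only [toDiag, Set.mem_ofPred_eq, hfc]
    exact and_congr_right fun _ => ⟨fun h => by rw [h], fun h => coord_injective h⟩

end FCDiagram

namespace FCDiagram

variable {n : ℕ}

/-! ### The product with a generator -/

theorem place_top (r r' : Fin 3) (x : Fin (n + 1)) : place r r' (top x : Dot n) = (r, x) := rfl

theorem place_bot (r r' : Fin 3) (x : Fin (n + 1)) : place r r' (bot x : Dot n) = (r', x) := rfl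

theorem reachable_of_mem_left {D₁ D₂ : Set (Dot n × Dot n)} {d e : Dot n} (h : (d, e) ∈ D₁) :
    (stackGraph D₁ D₂).Reachable (place 0 1 d) (place 0 1 e) := by
  by_cases hne : place 0 1 d = place 0 1 e
  · rw [hne]
  · apply SimpleGraph.Adj.reachable
    rw [stackGraph, SimpleGraph.fromRel_adj]
    exact ⟨hne, Or.inl (Or.inl ⟨_, h, rfl, rfl⟩)⟩

theorem reachable_of_mem_right {D₁ D₂ : Set (Dot n × Dot n)} {d e : Dot n} (h : (d, e) ∈ D₂) :
    (stackGraph D₁ D₂).Reachable (place 1 2 d) (place 1 2 e) := by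
  by_cases hne : place 1 2 d = place 1 2 e
  · rw [hne]
  · apply SimpleGraph.Adj.reachable
    rw [stackGraph, SimpleGraph.fromRel_adj]
    exact ⟨hne, Or.inl (Or.inr ⟨_, h, rfl, rfl⟩)⟩

/-- Dots are shown to be disconnected by a label that is constant along edges. -/
theorem eq_of_reachable {D₁ D₂ : Set (Dot n × Dot n)} {α : Type*} (c : StackDot n → α)
    (h₁ : ∀ d e, (d, e) ∈ D₁ → c (place 0 1 d) = c (place 0 1 e))
    (h₂ : ∀ d e, (d, e) ∈ D₂ → c (place 1 2 d) = c (place 1 2 e)) {u v : StackDot n}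
    (h : (stackGraph D₁ D₂).Reachable u v) : c u = c v := by
  obtain ⟨p⟩ := h
  induction p with
  | nil => rfl
  | cons hadj _ ih =>
    rw [← ih]
    rw [stackGraph, SimpleGraph.fromRel_adj] at hadj
    rcases hadj.2 with (⟨a, ha, rfl, rfl⟩ | ⟨a, ha, rfl, rfl⟩) | ⟨a, ha, rfl, rfl⟩ | ⟨a, ha, rfl, rfl⟩
    · exact h₁ _ _ ha
    · exact h₂ _ _ ha
    · exact (h₁ _ _ ha).symm
    · exact (h₂ _ _ ha).symm

section Product

variable {f : ℤ → ℤ} (k : Fin n)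

theorem reachable_of_apply_coord (hf : IsMatching (n + 1) f) (D₂ : Set (Dot n × Dot n))
    {d e : Dot n} (h : f (coord d) = coord e) :
    (stackGraph (toDiag n f) D₂).Reachable (place 0 1 d) (place 0 1 e) := by
  rcases lt_trichotomy d e with hlt | rfl | hlt
  · exact reachable_of_mem_left ⟨hlt, h⟩
  · exact SimpleGraph.Reachable.rfl
  · have hed : (e, d) ∈ toDiag n f := ⟨hlt, by rw [hf.eq_iff]; exact h.symm⟩
    exact (reachable_of_mem_left hed).symm

theorem reachable_middle (D₁ : Set (Dot n × Dot n)) :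
    (stackGraph D₁ (genDiagram k)).Reachable (1, k.castSucc) (1, k.succ) :=
  reachable_of_mem_right (d := top k.castSucc) (e := top k.succ) (by simp [genDiagram])

theorem reachable_bottom (D₁ : Set (Dot n × Dot n)) :
    (stackGraph D₁ (genDiagram k)).Reachable (2, k.castSucc) (2, k.succ) :=
  reachable_of_mem_right (d := bot k.castSucc) (e := bot k.succ) (by simp [genDiagram])

theorem reachable_through (D₁ : Set (Dot n × Dot n)) {x : Fin (n + 1)} (h₁ : x ≠ k.castSucc)
    (h₂ : x ≠ k.succ) : (stackGraph D₁ (genDiagram k)).Reachable (1, x) (2, x) :=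
  reachable_of_mem_right (d := top x) (e := bot x) (Or.inr ⟨x, h₁, h₂, rfl⟩)

theorem reachable_place (D₁ : Set (Dot n × Dot n)) {d : Dot n} (h₁ : coord d ≠ (k : ℕ) + 1)
    (h₂ : coord d ≠ (k : ℕ) + 1 + 1) :
    (stackGraph D₁ (genDiagram k)).Reachable (place 0 1 d) (place 0 2 d) := by
  rcases dot_cases d with ⟨x, rfl⟩ | ⟨x, rfl⟩
  · exact SimpleGraph.Reachable.rfl
  · apply reachable_through
    · rintro rfl
      simp at h₁
    · rintro rfl
      simp at h₂

theorem reachable_of_joinOp (hf : IsMatching (n + 1) f) {d e : Dot n}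
    (h : joinOp ((k : ℕ) + 1) ((k : ℕ) + 1 + 1) f (coord d) = coord e) :
    (stackGraph (toDiag n f) (genDiagram k)).Reachable (place 0 2 d) (place 0 2 e) := by
  have hc1 : coord (bot k.castSucc : Dot n) = (k : ℕ) + 1 := by simp
  have hc2 : coord (bot k.succ : Dot n) = (k : ℕ) + 1 + 1 := by simp
  have n1 := hf.ne ((k : ℕ) + 1) (by omega)
  have n2 := hf.ne ((k : ℕ) + 1 + 1) (by omega)
  -- The former partners of the two glued dots are connected through the upper join of the
  -- generator.
  have hpath : ∀ d e : Dot n, coord d = f ((k : ℕ) + 1) → coord e = f ((k : ℕ) + 1 + 1) →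
      coord d ≠ (k : ℕ) + 1 + 1 →
      (stackGraph (toDiag n f) (genDiagram k)).Reachable (place 0 2 d) (place 0 2 e) := by
    intro d e hd he hne
    have hne' : coord e ≠ (k : ℕ) + 1 := by
      intro h
      rw [h] at he
      rw [he, hf.invol] at hd
      exact hne hd
    have h1 := reachable_place k (toDiag n f) (by rw [hd]; exact n1) hne
    have h2 := reachable_place k (toDiag n f) hne' (by rw [he]; exact n2)
    have h3 := reachable_of_apply_coord hf (genDiagram k) (d := bot k.castSucc) (e := d)
      (by rw [hc1, hd])
    have h4 := reachable_of_apply_coord hf (genDiagram k) (d := bot k.succ) (e := e)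
      (by rw [hc2, he])
    exact h1.symm.trans (h3.symm.trans ((reachable_middle k _).trans (h4.trans h2)))
  unfold joinOp at h
  split_ifs at h with h1 h2 h3 h4
  · rw [coord_injective (h1.trans hc1.symm), coord_injective (h.symm.trans hc2.symm)]
    exact reachable_bottom k _
  · rw [coord_injective (h2.trans hc2.symm), coord_injective (h.symm.trans hc1.symm)]
    exact (reachable_bottom k _).symm
  · exact hpath d e h3 h.symm h2
  · refine (hpath e d h.symm h4 ?_).symm
    rw [← h]
    intro h5
    rw [hf.eq_iff] at h5
    rw [← h5] at h4
    exact h1 h4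
  · exact (reachable_place k _ h1 h2).symm.trans ((reachable_of_apply_coord hf _ h).trans
      (reachable_place k _ (by rw [← h]; intro h5; rw [hf.eq_iff] at h5; exact h3 h5)
        (by rw [← h]; intro h5; rw [hf.eq_iff] at h5; exact h4 h5)))

/-- A number attached to the join of `z` in the product with the generator `k`. -/
def joinLabel (f : ℤ → ℤ) (k : Fin n) (z : ℤ) : ℤ :=
  min z (joinOp ((k : ℕ) + 1) ((k : ℕ) + 1 + 1) f z)

/-- A function that is constant on the connected components of the stack of a diagram and the
generator `k`, and separates them. -/
def stackLabel (f : ℤ → ℤ) (k : Fin n) (v : StackDot n) : ℤ :=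
  if v.1 = 0 then joinLabel f k (-((v.2 : ℕ) + 1)) else
    if v.1 = 1 ∧ (v.2 = k.castSucc ∨ v.2 = k.succ) then
      if f ((k : ℕ) + 1) = (k : ℕ) + 1 + 1 then 0 else joinLabel f k (f ((k : ℕ) + 1))
    else joinLabel f k ((v.2 : ℕ) + 1)

theorem stackLabel_outer (d : Dot n) : stackLabel f k (place 0 2 d) = joinLabel f k (coord d) := by
  rcases dot_cases d with ⟨x, rfl⟩ | ⟨x, rfl⟩
  · rw [place_top, stackLabel, if_pos rfl, coord_top]
  · rw [place_bot, stackLabel, if_neg (by simp), if_neg (by simp), coord_bot]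

theorem stackLabel_upper (d : Dot n) : stackLabel f k (place 0 1 d) =
    if coord d = (k : ℕ) + 1 ∨ coord d = (k : ℕ) + 1 + 1 then
      if f ((k : ℕ) + 1) = (k : ℕ) + 1 + 1 then 0 else joinLabel f k (f ((k : ℕ) + 1))
    else joinLabel f k (coord d) := by
  rcases dot_cases d with ⟨x, rfl⟩ | ⟨x, rfl⟩
  · rw [place_top, stackLabel, if_pos rfl, coord_top, if_neg (by omega)]
  · have h1 : (x = k.castSucc ∨ x = k.succ) ↔
        (coord (bot x : Dot n) = (k : ℕ) + 1 ∨ coord (bot x : Dot n) = (k : ℕ) + 1 + 1) := by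
      rw [coord_bot, Fin.ext_iff, Fin.ext_iff, Fin.val_castSucc, Fin.val_succ]
      omega
    simp only [place_bot, stackLabel, ← h1]
    simp

theorem joinLabel_joinOp (hf : IsMatching (n + 1) f) (z : ℤ) :
    joinLabel f k (joinOp ((k : ℕ) + 1) ((k : ℕ) + 1 + 1) f z) = joinLabel f k z := by
  have hk := k.isLt
  have := (hf.joinOp (a := (k : ℕ) + 1) (b := (k : ℕ) + 1 + 1) (by omega) (by omega) (by omega)
    (by rw [abs_le]; omega) (by rw [abs_le]; omega)).invol z
  rw [joinLabel, joinLabel, this, min_comm]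

/-- The two middle dots glued to the upper join of the generator carry the label of the join they
become part of, or 0 if they close up into a circle. -/
theorem stackLabel_eq_of_reachable (hf : IsMatching (n + 1) f) {u v : StackDot n}
    (h : (stackGraph (toDiag n f) (genDiagram k)).Reachable u v) :
    stackLabel f k u = stackLabel f k v := by
  have n1 := hf.ne ((k : ℕ) + 1) (by omega)
  have n2 := hf.ne ((k : ℕ) + 1 + 1) (by omega)
  have hi := hf.invol
  have hinj : ∀ x y, f x = f y → x = y := fun x y => hf.inj
  refine eq_of_reachable (stackLabel f k) ?_ ?_ h
  · rintro d e ⟨-, hde⟩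
    simp only at hde
    have hl := joinLabel_joinOp k hf (coord d)
    have hl' := joinLabel_joinOp k hf (f ((k : ℕ) + 1))
    rw [stackLabel_upper, stackLabel_upper]
    rw [← hde]
    generalize coord d = z at *
    unfold joinOp at hl hl'
    generalize joinLabel f k = m at *
    generalize hκ : ((k : ℕ) : ℤ) + 1 = κ at *
    grind
  · intro d e hde
    rcases hde with hde | ⟨x, h1, h2, hde⟩
    · rcases hde with hde | hde
      · rw [Prod.mk.injEq] at hde
        obtain ⟨rfl, rfl⟩ := hde
        simp [place_top, stackLabel]
      · rw [Set.mem_singleton_iff, Prod.mk.injEq] at hde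
        obtain ⟨rfl, rfl⟩ := hde
        have := joinLabel_joinOp k hf ((k : ℕ) + 1)
        simp only [place_bot, stackLabel]
        simp only [joinOp, if_true] at this
        simp [this]
    · rw [Prod.mk.injEq] at hde
      obtain ⟨rfl, rfl⟩ := hde
      simp [place_top, place_bot, stackLabel, h1, h2]

/-- An explicit path gives one inclusion. For the other, connected outer dots have equal labels, and
a join is determined by the smaller of its endpoints. -/
theorem concat_genDiagram (hf : IsMatching (n + 1) f) :
    concat (toDiag n f) (genDiagram k) =
      toDiag n (joinOp ((k : ℕ) + 1) ((k : ℕ) + 1 + 1) f) := by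
  ext ⟨d, e⟩
  simp only [concat, toDiag, Set.mem_ofPred_eq]
  refine and_congr_right fun hlt => ⟨fun h => ?_, fun h => reachable_of_joinOp k hf h⟩
  have hl := stackLabel_eq_of_reachable k hf h
  rw [stackLabel_outer, stackLabel_outer] at hl
  have hne : coord d ≠ coord e := fun h => hlt.ne (coord_injective h)
  have hk := k.isLt
  have hi := (hf.joinOp (a := (k : ℕ) + 1) (b := (k : ℕ) + 1 + 1) (by omega) (by omega) (by omega)
    (by rw [abs_le]; omega) (by rw [abs_le]; omega)).invol
  have h1 := hi (coord d)
  have h2 := hi (coord e)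
  unfold joinLabel at hl
  generalize joinOp ((k : ℕ) + 1) ((k : ℕ) + 1 + 1) f = g at *
  rcases min_choice (coord d) (g (coord d)) with h3 | h3 <;>
    rcases min_choice (coord e) (g (coord e)) with h4 | h4 <;> rw [h3, h4] at hl
  · exact absurd hl hne
  · rw [hl, h2]
  · exact hl
  · rw [← h1, hl, h2] at hne
    exact absurd rfl hne

/-- A middle dot away from the generator is tied to the bottom row, so the component of the upper
join is the only possible circle. If its dots are joined in the upper diagram, its label is 0, which
no outer dot has; otherwise the partner leads to an outer row. -/
theorem circles_genDiagram (hf : IsMatching (n + 1) f) :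
    circles (toDiag n f) (genDiagram k) = circleCount f ((k : ℕ) + 1) := by
  have hk := k.isLt
  have hg := hf.joinOp (a := (k : ℕ) + 1) (b := (k : ℕ) + 1 + 1) (by omega) (by omega) (by omega)
    (by rw [abs_le]; omega) (by rw [abs_le]; omega)
  have hmid : ∀ c : (stackGraph (toDiag n f) (genDiagram k)).ConnectedComponent,
      (∀ v ∈ c.supp, v.1 = 1) →
      c = (stackGraph (toDiag n f) (genDiagram k)).connectedComponentMk (1, k.castSucc) := by
    intro c
    refine c.ind ?_
    rintro ⟨r, x⟩ hc
    have hr : r = 1 := hc (r, x) rfl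
    subst hr
    by_cases h1 : x = k.castSucc
    · rw [h1]
    by_cases h2 : x = k.succ
    · rw [h2]
      exact SimpleGraph.ConnectedComponent.sound (reachable_middle k _).symm
    · have := hc (2, x) (SimpleGraph.ConnectedComponent.sound (reachable_through k _ h1 h2).symm)
      simp at this
  unfold circles circleCount
  split_ifs with h
  · rw [Set.ncard_eq_one]
    refine ⟨(stackGraph (toDiag n f) (genDiagram k)).connectedComponentMk (1, k.castSucc), ?_⟩
    ext c
    rw [Set.mem_singleton_iff]
    refine ⟨hmid c, ?_⟩
    rintro rfl ⟨r, x⟩ hv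
    have hl := stackLabel_eq_of_reachable k hf (SimpleGraph.ConnectedComponent.exact hv)
    have hl0 : stackLabel f k (1, k.castSucc) = 0 := by simp [stackLabel, h]
    rw [hl0] at hl
    have hout : ∀ d : Dot n, place 0 2 d ≠ (r, x) := by
      intro d hd
      rw [← hd, stackLabel_outer, joinLabel] at hl
      have h1 := coord_ne_zero d
      have h2 := hg.apply_ne_zero h1
      rcases min_choice (coord d) (joinOp ((k : ℕ) + 1) ((k : ℕ) + 1 + 1) f (coord d)) with h3 | h3
      · exact h1 (h3.symm.trans hl)
      · exact h2 (h3.symm.trans hl)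
    have h0 := hout (top x)
    have h2 := hout (bot x)
    rw [place_top] at h0
    rw [place_bot] at h2
    fin_cases r
    · exact absurd rfl h0
    · rfl
    · exact absurd rfl h2
  · rw [Set.ncard_eq_zero, Set.eq_empty_iff_forall_notMem]
    intro c hc
    have hc1 := hmid c hc
    subst hc1
    obtain ⟨e, he⟩ := exists_coord_eq_apply hf (bot k.castSucc)
    have hc1 : coord (bot k.castSucc : Dot n) = (k : ℕ) + 1 := by simp
    rw [hc1] at he
    have hr1 := reachable_of_apply_coord hf (genDiagram k) (d := bot k.castSucc) (e := e)
      (by rw [hc1, he])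
    have hr2 := reachable_place k (toDiag n f) (d := e)
      (by rw [← he]; exact hf.ne _ (by omega)) (by rw [← he]; exact h)
    have hrow := hc (place 0 2 e)
      (SimpleGraph.ConnectedComponent.sound (hr1.trans hr2).symm)
    rcases dot_cases e with ⟨x, rfl⟩ | ⟨x, rfl⟩
    · rw [place_top] at hrow; simp at hrow
    · rw [place_bot] at hrow; simp at hrow

end Product

theorem monomial_eq (ω : List (Fin n)) :
    monomial ω = ((wordAct (0, fun z => -z) ω).1, toDiag n (wordAct (0, fun z => -z) ω).2) := by
  have key : ∀ (ω : List (Fin n)) (P : ℕ × (ℤ → ℤ)), IsMatching (n + 1) P.2 →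
      ω.foldl (fun P k => (P.1 + circles P.2 (genDiagram k), concat P.2 (genDiagram k)))
        (P.1, toDiag n P.2) = ((wordAct P ω).1, toDiag n (wordAct P ω).2) := by
    intro ω
    induction ω with
    | nil => intro P _; rfl
    | cons k ω ih =>
      intro P hP
      rw [List.foldl_cons, circles_genDiagram k hP, concat_genDiagram k hP]
      exact ih (genAct P k) (isMatching_genAct hP k)
  rw [monomial, idDiagram_eq]
  exact key ω (0, fun z => -z) (isMatching_neg _)

end FCDiagram

namespace FCDiagram

open Relation

variable {n : ℕ}

/-! ### Tails, heads and size -/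

theorem mem_topArrows_union_posArrows {f : ℤ → ℤ} (d e : Dot n) :
    (d, e) ∈ topArrows (toDiag n f) ∪ posArrows (toDiag n f) ↔
      (d, e) ∈ toDiag n f ∧ ∃ x : Fin (n + 1), d = top x ∧ IsTail f ((x : ℕ) + 1) := by
  simp only [topArrows, posArrows, toDiag, Set.mem_union, Set.mem_ofPred_eq, Prod.mk.injEq, IsTail]
  constructor
  · rintro (⟨⟨hlt, h⟩, x, y, rfl, rfl⟩ | ⟨⟨hlt, h⟩, x, y, ⟨rfl, rfl⟩, hxy⟩)
    · refine ⟨⟨hlt, h⟩, x, rfl, Or.inl ?_⟩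
      rw [top_lt_top, Fin.lt_def] at hlt
      simp only [coord_top] at h
      rw [h]; omega
    · refine ⟨⟨hlt, h⟩, x, rfl, Or.inr ?_⟩
      rw [bot_lt_bot, Fin.lt_def] at hxy
      simp only [coord_top, coord_bot] at h
      rw [h]; omega
  · rintro ⟨⟨hlt, h⟩, x, rfl, ht⟩
    rcases dot_cases e with ⟨y, rfl⟩ | ⟨y, rfl⟩
    · exact Or.inl ⟨⟨hlt, h⟩, x, y, rfl, rfl⟩
    · refine Or.inr ⟨⟨hlt, h⟩, x, y, ⟨rfl, rfl⟩, ?_⟩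
      simp only [coord_top, coord_bot] at h
      rw [h] at ht
      rw [bot_lt_bot, Fin.lt_def]; omega

theorem mem_botArrows_union_posArrows {f : ℤ → ℤ} (hf : IsMatching (n + 1) f) (d e : Dot n) :
    (d, e) ∈ botArrows (toDiag n f) ∪ posArrows (toDiag n f) ↔
      (d, e) ∈ toDiag n f ∧ ∃ y : Fin (n + 1), e = bot y ∧ IsHead f ((y : ℕ) + 1) := by
  simp only [botArrows, posArrows, toDiag, Set.mem_union, Set.mem_ofPred_eq, Prod.mk.injEq, IsHead]
  constructor
  · rintro (⟨⟨hlt, h⟩, x, y, rfl, rfl⟩ | ⟨⟨hlt, h⟩, x, y, ⟨rfl, rfl⟩, hxy⟩)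
    · refine ⟨⟨hlt, h⟩, y, rfl, ?_⟩
      rw [bot_lt_bot, Fin.lt_def] at hlt
      rw [hf.eq_iff] at h
      simp only [coord_bot] at h
      rw [← h]; omega
    · refine ⟨⟨hlt, h⟩, y, rfl, ?_⟩
      rw [bot_lt_bot, Fin.lt_def] at hxy
      rw [hf.eq_iff] at h
      simp only [coord_top, coord_bot] at h
      rw [← h]; omega
  · rintro ⟨⟨hlt, h⟩, y, rfl, ht⟩
    rcases dot_cases d with ⟨x, rfl⟩ | ⟨x, rfl⟩
    · refine Or.inr ⟨⟨hlt, h⟩, x, y, ⟨rfl, rfl⟩, ?_⟩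
      rw [hf.eq_iff] at h
      simp only [coord_top, coord_bot] at h
      rw [← h] at ht
      rw [bot_lt_bot, Fin.lt_def]; omega
    · exact Or.inl ⟨⟨hlt, h⟩, x, y, rfl, rfl⟩

theorem mem_tailSet_toDiag {f : ℤ → ℤ} (hf : IsMatching (n + 1) f) (i : ℕ) :
    i ∈ tailSet (toDiag n f) ↔ 1 ≤ i ∧ i ≤ n + 1 ∧ IsTail f i := by
  constructor
  · rintro ⟨x, e, rfl, h⟩
    obtain ⟨-, x', hx, h⟩ := (mem_topArrows_union_posArrows _ _).1 h
    have := coord_injective.eq_iff.2 hx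
    simp only [coord_top] at this
    obtain rfl : x = x' := Fin.ext (by omega)
    exact ⟨by omega, by omega, by push_cast; exact h⟩
  · rintro ⟨h1, h2, h⟩
    obtain ⟨m, rfl⟩ : ∃ m, i = m + 1 := ⟨i - 1, by omega⟩
    push_cast at h
    obtain ⟨e, he⟩ := exists_coord_eq_apply hf (top ⟨m, by omega⟩)
    refine ⟨⟨m, by omega⟩, e, rfl, ?_⟩
    rw [mem_topArrows_union_posArrows]
    refine ⟨⟨?_, he⟩, _, rfl, h⟩
    rcases dot_cases e with ⟨y, rfl⟩ | ⟨y, rfl⟩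
    · simp only [coord_top] at he
      unfold IsTail at h
      rw [he] at h
      change (top _ : Dot n) < top _
      rw [top_lt_top, Fin.lt_def]
      simp only; omega
    · exact top_lt_bot _ _

theorem mem_headSet_toDiag {f : ℤ → ℤ} (hf : IsMatching (n + 1) f) (j : ℕ) :
    j ∈ headSet (toDiag n f) ↔ 1 ≤ j ∧ j ≤ n ∧ IsHead f (j + 1) := by
  constructor
  · rintro ⟨h1, -, d, y, hy, h⟩
    obtain ⟨-, y', hy', h⟩ := (mem_botArrows_union_posArrows hf _ _).1 h
    have := coord_injective.eq_iff.2 hy'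
    simp only [coord_bot] at this
    obtain rfl : y = y' := Fin.ext (by omega)
    obtain rfl : j = y := by omega
    exact ⟨h1, by omega, h⟩
  · rintro ⟨h1, h2, h⟩
    obtain ⟨d, hd⟩ := exists_coord_eq_apply hf (bot ⟨j, by omega⟩)
    refine ⟨h1, by omega, d, ⟨j, by omega⟩, rfl, ?_⟩
    rw [mem_botArrows_union_posArrows hf]
    refine ⟨⟨?_, by rw [hf.eq_iff]; exact hd.symm⟩, _, rfl, h⟩
    rcases dot_cases d with ⟨x, rfl⟩ | ⟨x, rfl⟩
    · exact top_lt_bot _ _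
    · simp only [coord_bot] at hd
      unfold IsHead at h
      rw [hd] at h
      change (bot _ : Dot n) < bot _
      rw [bot_lt_bot, Fin.lt_def]
      simp only; omega

/-- An arrow is determined by its tail. -/
theorem size_toDiag {f : ℤ → ℤ} : size (toDiag n f) = (tailSet (toDiag n f)).ncard := by
  have himg : tailSet (toDiag n f) =
      (fun a : Dot n × Dot n => (-coord a.1).toNat) ''
        (topArrows (toDiag n f) ∪ posArrows (toDiag n f)) := by
    ext i
    constructor
    · rintro ⟨x, e, rfl, h⟩
      exact ⟨_, h, by simp only [coord_top]; omega⟩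
    · rintro ⟨⟨d, e⟩, h, rfl⟩
      obtain ⟨-, x, rfl, -⟩ := (mem_topArrows_union_posArrows _ _).1 h
      exact ⟨x, e, by simp only [coord_top]; omega, h⟩
  rw [himg, Set.InjOn.ncard_image]
  · rfl
  · rintro ⟨d, e⟩ h ⟨d', e'⟩ h' heq
    obtain ⟨⟨-, h1⟩, x, rfl, -⟩ := (mem_topArrows_union_posArrows _ _).1 h
    obtain ⟨⟨-, h1'⟩, x', rfl, -⟩ := (mem_topArrows_union_posArrows _ _).1 h'
    simp only [coord_top] at heq h1 h1'
    obtain rfl : x = x' := Fin.ext (by omega)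
    rw [coord_injective (h1.symm.trans h1')]

/-! ### Diagrams of normal words and the bijection with fully commutative elements -/

/-- The diagram of a normal list of pairs. -/
def normalDiag (n : ℕ) (L : List (ℕ × ℕ)) : Set (Dot n × Dot n) :=
  toDiag n (wordAct (0, fun z => -z) (normalWord n L)).2

theorem monomial_normalWord {L : List (ℕ × ℕ)} (hL : IsNormal n L) :
    monomial (normalWord n L) = (0, normalDiag n L) := by
  rw [monomial_eq, (wordAct_normalWord hL).1, normalDiag]

theorem tailSet_normalDiag {L : List (ℕ × ℕ)} (hL : IsNormal n L) :
    tailSet (normalDiag n L) = {i | i ∈ L.map Prod.fst} := by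
  ext i
  rw [normalDiag, mem_tailSet_toDiag (isMatching_wordAct (isMatching_neg _) _), Set.mem_ofPred_eq,
    List.mem_map]
  constructor
  · rintro ⟨h1, -, h⟩
    obtain ⟨q, hq, h⟩ := ((wordAct_normalWord hL).2.1 i (by omega)).1 h
    exact ⟨q, hq, by omega⟩
  · rintro ⟨q, hq, rfl⟩
    have := hL.2 q hq
    exact ⟨by omega, by omega, ((wordAct_normalWord hL).2.1 _ (by omega)).2 ⟨q, hq, rfl⟩⟩

theorem headSet_normalDiag {L : List (ℕ × ℕ)} (hL : IsNormal n L) :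
    headSet (normalDiag n L) = {j | j ∈ L.map Prod.snd} := by
  ext j
  rw [normalDiag, mem_headSet_toDiag (isMatching_wordAct (isMatching_neg _) _), Set.mem_ofPred_eq,
    List.mem_map]
  constructor
  · rintro ⟨h1, -, h⟩
    obtain ⟨q, hq, h⟩ := ((wordAct_normalWord hL).2.2.1 _ (by omega)).1 h
    exact ⟨q, hq, by omega⟩
  · rintro ⟨q, hq, rfl⟩
    have := hL.2 q hq
    exact ⟨by omega, by omega, ((wordAct_normalWord hL).2.2.1 _ (by omega)).2 ⟨q, hq, rfl⟩⟩

theorem IsNormal.pairwise_fst {L : List (ℕ × ℕ)} (hL : IsNormal n L) :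
    (L.map Prod.fst).Pairwise (· > ·) :=
  List.pairwise_map.2 (hL.1.imp fun h => h.1)

theorem IsNormal.pairwise_snd {L : List (ℕ × ℕ)} (hL : IsNormal n L) :
    (L.map Prod.snd).Pairwise (· > ·) :=
  List.pairwise_map.2 (hL.1.imp fun h => h.2)

theorem size_normalDiag {L : List (ℕ × ℕ)} (hL : IsNormal n L) :
    size (normalDiag n L) = L.length := by
  have h : tailSet (normalDiag n L) = ((L.map Prod.fst).toFinset : Set ℕ) := by
    rw [tailSet_normalDiag hL]; ext; simp
  rw [normalDiag, size_toDiag, ← normalDiag, h, Set.ncard_coe_finset,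
    List.toFinset_card_of_nodup (hL.pairwise_fst.imp fun h => h.ne'), List.length_map]

theorem eq_of_pairwise_gt {l l' : List ℕ} (h : l.Pairwise (· > ·)) (h' : l'.Pairwise (· > ·))
    (hm : ∀ a, a ∈ l ↔ a ∈ l') : l = l' := by
  refine List.Perm.eq_of_pairwise (fun a b _ _ hab hba => absurd hab hba.not_gt) h h' ?_
  rw [List.perm_ext_iff_of_nodup (h.imp fun h => h.ne') (h'.imp fun h => h.ne')]
  exact hm

/-- The tails and the heads determine the normal list. -/
theorem IsNormal.eq_of_tailSet_eq {L L' : List (ℕ × ℕ)} (hL : IsNormal n L) (hL' : IsNormal n L')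
    (ht : tailSet (normalDiag n L) = tailSet (normalDiag n L'))
    (hh : headSet (normalDiag n L) = headSet (normalDiag n L')) : L = L' := by
  rw [tailSet_normalDiag hL, tailSet_normalDiag hL'] at ht
  rw [headSet_normalDiag hL, headSet_normalDiag hL'] at hh
  have h1 := eq_of_pairwise_gt hL.pairwise_fst hL'.pairwise_fst fun a => Set.ext_iff.1 ht a
  have h2 := eq_of_pairwise_gt hL.pairwise_snd hL'.pairwise_snd fun a => Set.ext_iff.1 hh a
  exact (List.zip_of_prod h1 h2).trans (List.zip_of_prod rfl rfl).symm

theorem IsNonCrossingDiagram.exists_normalDiag {D : Set (Dot n × Dot n)}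
    (hD : IsNonCrossingDiagram D) : ∃ L, IsNormal n L ∧ D = normalDiag n L := by
  obtain ⟨f, hf, hp, rfl⟩ := hD.exists_toDiag
  obtain ⟨L, hL, h⟩ := exists_isNormal_wordAct_eq hf hp
  exact ⟨L, hL, by rw [normalDiag, h]⟩

theorem pairsWord_getElem (L : List (ℕ × ℕ)) :
    pairsWord n (fun k : Fin L.length => L[k].1) (fun k => L[k].2) = normalWord n L := by
  rw [pairsWord, normalWord, List.flatMap_def]
  congr 1
  conv_rhs => rw [← List.ofFn_getElem (xs := L), List.map_ofFn]
  rfl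

theorem isGood_normalWord {L : List (ℕ × ℕ)} (hL : IsNormal n L) :
    IsGood (CoxeterMatrix.A n) (normalWord n L) :=
  (isAlternating_normalWord hL).isGood

theorem isReduced_normalWord {L : List (ℕ × ℕ)} (hL : IsNormal n L) :
    (cox n).IsReduced (normalWord n L) :=
  (isGood_normalWord hL).isReduced (cox n) typeA_eq_two_or_three cox_simple_injective

/-- All reduced words of the element are commutation equivalent to the normal word, and commutations
change neither the diagram nor the number of circles. -/
theorem isDiagramOf_normalWord {L : List (ℕ × ℕ)} (hL : IsNormal n L) :
    IsDiagramOf ((cox n).wordProd (normalWord n L)) (normalDiag n L) := by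
  intro ω hω hw
  have h := (isGood_normalWord hL).reflTransGen (cox n) typeA_eq_two_or_three cox_simple_injective
    (isReduced_normalWord hL) hω hw.symm
  rw [monomial_eq, ← wordAct_eq_of_reflTransGen (isMatching_neg _) h, ← monomial_eq,
    monomial_normalWord hL]

/-- The element `w` has a normal word as well; its diagram is the given one, and tails and heads
force the two lists of pairs to agree. -/
theorem eq_wordProd_normalWord {L : List (ℕ × ℕ)} (hL : IsNormal n L)
    {w : (CoxeterMatrix.A n).Group} (hw : IsFullyCommutative (cox n) w)
    (hD : IsDiagramOf w (normalDiag n L)) : w = (cox n).wordProd (normalWord n L) := by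
  obtain ⟨ω, hω, rfl⟩ := (cox n).exists_isReduced w
  obtain ⟨L', hL', h⟩ := (hw.isGood (cox n) hω).exists_isNormal
  have hp := wordProd_eq_of_reflTransGen (cox n) h
  have hm := hD _ (isReduced_of_reflTransGen (cox n) h hω) hp.symm
  rw [monomial_normalWord hL', Prod.mk.injEq] at hm
  rw [hp, hL'.eq_of_tailSet_eq hL (by rw [hm.2]) (by rw [hm.2])]

end FCDiagram

theorem mainTheorem3 (n : ℕ) (D : Set (FCDiagram.Dot n × FCDiagram.Dot n))
    (hD : FCDiagram.IsNonCrossingDiagram D) :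
    (∃ i j : Fin (FCDiagram.size D) → ℕ,
      StrictAnti i ∧ StrictAnti j ∧
      Set.range i = FCDiagram.tailSet D ∧ Set.range j = FCDiagram.headSet D ∧
      (∀ k, 1 ≤ i k ∧ i k ≤ j k ∧ j k ≤ n) ∧
      (FCDiagram.cox n).IsReduced (FCDiagram.pairsWord n i j) ∧
      FCDiagram.IsFullyCommutative (FCDiagram.cox n)
        ((FCDiagram.cox n).wordProd (FCDiagram.pairsWord n i j)) ∧
      FCDiagram.IsDiagramOf ((FCDiagram.cox n).wordProd (FCDiagram.pairsWord n i j)) D ∧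
      ∀ w : (CoxeterMatrix.A n).Group, FCDiagram.IsFullyCommutative (FCDiagram.cox n) w →
        FCDiagram.IsDiagramOf w D →
        w = (FCDiagram.cox n).wordProd (FCDiagram.pairsWord n i j)) ∧
    ∀ D' : Set (FCDiagram.Dot n × FCDiagram.Dot n), FCDiagram.IsNonCrossingDiagram D' →
      FCDiagram.tailSet D' = FCDiagram.tailSet D → FCDiagram.headSet D' = FCDiagram.headSet D →
      D' = D := by
  obtain ⟨L, hL, rfl⟩ := hD.exists_normalDiag
  refine ⟨?_, ?_⟩
  -- Once the size is the length of `L`, the two sequences are the components of `L`.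
  · rw [FCDiagram.size_normalDiag hL]
    have hpw := List.pairwise_iff_get.1 hL.1
    refine ⟨fun k => L[k].1, fun k => L[k].2, fun a b hab => (hpw a b hab).1,
      fun a b hab => (hpw a b hab).2, ?_, ?_, fun k => hL.2 _ (List.getElem_mem _), ?_⟩
    · rw [FCDiagram.tailSet_normalDiag hL]
      ext i
      simp [List.mem_iff_getElem, Fin.exists_iff]
    · rw [FCDiagram.headSet_normalDiag hL]
      ext i
      simp [List.mem_iff_getElem, Fin.exists_iff]
    · rw [FCDiagram.pairsWord_getElem]
      exact ⟨FCDiagram.isReduced_normalWord hL,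
        (FCDiagram.isGood_normalWord hL).isFullyCommutative _ FCDiagram.typeA_eq_two_or_three
          FCDiagram.cox_simple_injective,
        FCDiagram.isDiagramOf_normalWord hL,
        fun w hw hDw => FCDiagram.eq_wordProd_normalWord hL hw hDw⟩
  · intro D' hD' ht hh
    obtain ⟨L', hL', rfl⟩ := hD'.exists_normalDiag
    rw [hL'.eq_of_tailSet_eq hL ht hh]
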